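/- Conventions. $S,S'$ are closed (compact, connected) oriented surfaces. A (generalized) pseudo-Anosov homeomorphism $f:S\to S$ is an orientation-preserving homeomorphism with two transverse singular measured foliations $(\mathcal F^s,\mu^s)$, $(\mathcal F^u,\mu^u)$, having the same finite singular set and the same types of singularities ($k$-prongs, $k\ge 1$), and a number $\lambda>1$ such that $f_*(\mathcal F^u,\mu^u)=(\mathcal F^u,\lambda\mu^u)$ and $f_*(\mathcal F^s,\mu^s)=(\mathcal F^s,\lambda^{-1}\mu^s)$. A rectangle is the image of a continuous map $[0,1]^2\to S$ that is an orientation-preserving homeomorphism from the open square onto an open set (the interior $\mathring R$) and injective on each horizontal and each vertical segment, sending these into leaves of $\mathcal F^s$ and of $\mathcal F^u$ respectively; it is geometric if a vertical direction is chosen (the horizontal direction is then fixed by the orientation of $S$). A geometric Markov partition $\mathcal R=\{R_i\}_{i=1}^n$ of $f$ is a finite family of geometric rectangles with disjoint interiors covering $S$ such that the closure of each component of $\mathring R_i\cap f^{-1}(\mathring R_j)$ is a horizontal subrectangle of $R_i$, and the closure of each component of $f(\mathring R_i)\cap\mathring R_j$ is a vertical subrectangle of $R_j$. An abstract geometric type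 is $T=(n,\{(h_i,v_i)\}_{i=1}^n,\rho,\epsilon)$ with positive integers $n,h_i,v_i$, $\sum_i h_i=\sum_i v_i$, a bijection $\rho$ from $\mathcal H(T)=\{(i,j):1\le i\le n,\,1\le j\le h_i\}$ to $\mathcal V(T)=\{(k,l):1\le k\le n,\,1\le l\le v_k\}$, and a map $\epsilon:\mathcal H(T)\to\{-1,1\}$; its incidence matrix $A(T)$ has entries $a_{ik}=\#\{j:\rho(i,j)=(k,l)\text{ for some }l\}$. The pair $(f,\mathcal R)$ has geometric type $T$, written $\mathcal T(f,\mathcal R)=T$, if $\mathcal R$ has $n$ rectangles, the horizontal subrectangles of $R_i$ are, from bottom to top, $H^i_1,\dots,H^i_{h_i}$, the vertical subrectangles of $R_k$ are, from left to right, $V^k_1,\dots,V^k_{v_k}$, one has $f(H^i_j)=V^k_l$ with $(k,l)=\rho(i,j)$, and $\epsilon(i,j)=1$ if and only if $f$ carries the vertical direction of $H^i_j$ (that of $R_i$) to that of $V^k_l$ (that of $R_k$). The incidence matrix $A(f,\mathcal R)$ counts the horizontal subrectangles of $R_i$ that $f$ sends to vertical subrectangles of $R_k$. The horizontal refinement $\mathbf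 B(\mathcal R)$ is the family of all $H^i_j$, $(i,j)\in\mathcal H(T)$, with the directions of $R_i$, enumerated as $H_{r(i,j)}=H^i_j$ by the lexicographic rank $r(i,j)=\sum_{i'<i}h_{i'}+j$. For an abstract geometric type $T$ let $\mathcal B(T)=(n',\{(h'_a,v'_a)\},\rho',\epsilon')$ with $n'=\sum_i h_i$ and, if $\rho(i,j)=(k,l)$, $$h'_{r(i,j)}=h_k,\qquad v'_{r(i,j)}=v_i,\qquad \rho'(r(i,j),j_0)=(r(k,m),l),\qquad \epsilon'(r(i,j),j_0)=\epsilon(i,j),$$ where $m=j_0$ if $\epsilon(i,j)=1$ and $m=h_k-(j_0-1)$ if $\epsilon(i,j)=-1$. Proposition. (1) $T\mapsto\mathcal B(T)$ is computable by an algorithm (on the finite lists of numbers that describe geometric types). (2) Let $f:S\to S$ and $g:S'\to S'$ be pseudo-Anosov homeomorphisms with geometric Markov partitions $\mathcal R_f$ and $\mathcal R_g$ of the same geometric type $T=\mathcal T(f,\mathcal R_f)=\mathcal T(g,\mathcal R_g)$. Then the horizontal refinements $\mathbf B(\mathcal R_f)$ and $\mathbf B(\mathcal R_g)$ exist, they are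 geometric Markov partitions of $f$ and of $g$, their geometric types are the same, $$\mathcal T(f,\mathbf B(\mathcal R_f))=\mathcal T(g,\mathbf B(\mathcal R_g))=\mathcal B(T),$$ and the incidence matrix $A(\mathcal B(T))=A(f,\mathbf B(\mathcal R_f))=A(g,\mathbf B(\mathcal R_g))$ is binary (all entries are $0$ or $1$). In particular $\mathcal B(T)$ is symbolically presentable: it is the geometric type of a geometric Markov partition of a pseudo-Anosov homeomorphism, and its incidence matrix is binary. -/

import Mathlib

open Set Filter Topology

universe u v

/-! ### Abstract geometric types -/

/-- An abstract geometric type `(n, {(h_i, v_i)}, ρ, ε)`. Indices start at `0`: the label `(i, j)`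
of the literature is `⟨i - 1, j - 1⟩` here. -/
structure GeometricType where
  /-- number of base rectangles -/
  n : ℕ
  /-- number of horizontal sub-rectangles of each base rectangle -/
  h : Fin n → ℕ
  /-- number of vertical sub-rectangles of each base rectangle -/
  v : Fin n → ℕ
  n_pos : 0 < n
  h_pos : ∀ i, 0 < h i
  v_pos : ∀ i, 0 < v i
  balance : ∑ i, h i = ∑ i, v i
  /-- permutation part, a bijection from horizontal labels to vertical labels -/
  ρ : (Σ i, Fin (h i)) ≃ (Σ k, Fin (v k))
  /-- orientation part, with values in `{-1, 1}` -/
  ε : (Σ i, Fin (h i)) → ℤˣ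

namespace GeometricType

/-- The set `ℋ(T)` of horizontal labels. -/
abbrev HLabel (T : GeometricType) : Type := Σ i, Fin (T.h i)

/-- The set `𝒱(T)` of vertical labels. -/
abbrev VLabel (T : GeometricType) : Type := Σ k, Fin (T.v k)

/-- The incidence matrix: `a_{ik}` is the number of `j` such that `ρ(i,j) = (k,l)` for some `l`. -/
def incidence (T : GeometricType) : Matrix (Fin T.n) (Fin T.n) ℕ :=
  fun i k => (Finset.univ.filter fun j : Fin (T.h i) => (T.ρ ⟨i, j⟩).1 = k).card

/-- The lexicographic enumeration `r(i,j) = ∑_{i' < i} h_{i'} + j` of the horizontal labels. -/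
def lex (T : GeometricType) : T.HLabel ≃ Fin (∑ i, T.h i) := finSigmaFinEquiv

/-- The position `j` if `e = 1`, and the position `j` counted from the other end otherwise. -/
def flip (e : ℤˣ) {m : ℕ} (j : Fin m) : Fin m := if e = 1 then j else j.rev

theorem flip_flip (e : ℤˣ) {m : ℕ} (j : Fin m) : flip e (flip e j) = j := by
  unfold flip; split_ifs <;> simp

theorem sigmaFin_ext {α : Type*} {m : α → ℕ} {x y : Σ a, Fin (m a)}
    (h1 : x.1 = y.1) (h2 : (x.2 : ℕ) = y.2) : x = y := by
  obtain ⟨a, i⟩ := x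
  obtain ⟨b, j⟩ := y
  obtain rfl : a = b := h1
  obtain rfl : i = j := Fin.ext h2
  rfl

theorem flip_val_congr {α : Type*} {m : α → ℕ} {a b : α} (hab : a = b) {e e' : ℤˣ} (he : e = e')
    {i : Fin (m a)} {j : Fin (m b)} (hij : (i : ℕ) = j) :
    (flip e i : ℕ) = flip e' j := by
  subst hab he
  obtain rfl : i = j := Fin.ext hij
  rfl

/-- The binary refinement `ℬ(T)`. Its base rectangles are the horizontal labels of `T`, ordered
lexicographically by `r`. If `ρ(i,j) = (k,l)`, then the rectangle `r(i,j)` has `h_k` horizontal and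
`v_i` vertical sub-rectangles, and `ρ'(r(i,j), j₀) = (r(k,m), l)`, `ε'(r(i,j), j₀) = ε(i,j)`,
where `m = j₀` if `ε(i,j) = 1`, and `m` is the `j₀`-th position from the top if `ε(i,j) = -1`. -/
def binaryRefinement (T : GeometricType) : GeometricType where
  n := ∑ i, T.h i
  h := fun a => T.h (T.ρ (T.lex.symm a)).1
  v := fun a => T.v (T.lex.symm a).1
  n_pos := Finset.sum_pos (fun i _ => T.h_pos i) ⟨⟨0, T.n_pos⟩, Finset.mem_univ _⟩
  h_pos := fun _ => T.h_pos _
  v_pos := fun _ => T.v_pos _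
  balance := by
    rw [Equiv.sum_comp T.lex.symm (fun x => T.h (T.ρ x).1),
      Equiv.sum_comp T.lex.symm (fun x => T.v x.1), Equiv.sum_comp T.ρ (fun y => T.h y.1)]
    simp [Fintype.sum_sigma, mul_comm]
  ρ :=
    { toFun := fun x =>
        ⟨T.lex ⟨(T.ρ (T.lex.symm x.1)).1, flip (T.ε (T.lex.symm x.1)) x.2⟩,
          Fin.cast (by simp) (T.ρ (T.lex.symm x.1)).2⟩
      invFun := fun y =>
        ⟨T.lex (T.ρ.symm ⟨(T.lex.symm y.1).1, y.2⟩),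
          Fin.cast (by simp)
            (flip (T.ε (T.ρ.symm ⟨(T.lex.symm y.1).1, y.2⟩)) (T.lex.symm y.1).2)⟩
      left_inv := by
        intro x
        have key : T.ρ.symm ⟨(T.lex.symm (T.lex ⟨(T.ρ (T.lex.symm x.1)).1,
            flip (T.ε (T.lex.symm x.1)) x.2⟩)).1,
            Fin.cast (by simp) (T.ρ (T.lex.symm x.1)).2⟩ = T.lex.symm x.1 := by
          rw [Equiv.symm_apply_eq]
          exact sigmaFin_ext (by simp) (by simp)
        refine sigmaFin_ext ?_ ?_
        · dsimp only
          rw [key]; simp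
        · dsimp only
          rw [Fin.val_cast]
          refine (flip_val_congr (m := T.h) (b := (T.ρ (T.lex.symm x.1)).1)
            (e' := T.ε (T.lex.symm x.1))
            (j := flip (T.ε (T.lex.symm x.1)) x.2) ?_ ?_ ?_).trans ?_
          · simp
          · rw [key]
          · rw [Equiv.symm_apply_apply]
          · rw [flip_flip]
      right_inv := by
        intro y
        have key : T.lex.symm (T.lex (T.ρ.symm ⟨(T.lex.symm y.1).1, y.2⟩)) =
            T.ρ.symm ⟨(T.lex.symm y.1).1, y.2⟩ := Equiv.symm_apply_apply _ _
        have key2 : T.ρ (T.lex.symm (T.lex (T.ρ.symm ⟨(T.lex.symm y.1).1, y.2⟩))) =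
            ⟨(T.lex.symm y.1).1, y.2⟩ := by rw [key, Equiv.apply_symm_apply]
        refine sigmaFin_ext ?_ ?_
        · dsimp only
          rw [← Equiv.eq_symm_apply]
          refine sigmaFin_ext ?_ ?_
          · dsimp only
            rw [key2]
          · dsimp only
            refine (flip_val_congr (m := T.h) (b := (T.lex.symm y.1).1)
              (e' := T.ε (T.ρ.symm ⟨(T.lex.symm y.1).1, y.2⟩))
              (j := flip (T.ε (T.ρ.symm ⟨(T.lex.symm y.1).1, y.2⟩)) (T.lex.symm y.1).2)
              ?_ ?_ ?_).trans ?_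
            · rw [key2]
            · rw [key]
            · simp
            · rw [flip_flip]
        · dsimp only
          rw [Fin.val_cast, key2] }
  ε := fun x => T.ε (T.lex.symm x.1)

/-- A geometric type as finite data: the list over `i` of `v_i` together with the list over `j` of
the triples `(k, l, [ε(i,j) = 1])` with `ρ(i,j) = (k,l)`. -/
def code (T : GeometricType) : List (ℕ × List (ℕ × ℕ × Bool)) :=
  List.ofFn fun i => (T.v i, List.ofFn fun j =>
    (((T.ρ ⟨i, j⟩).1 : ℕ), ((T.ρ ⟨i, j⟩).2 : ℕ), decide (T.ε ⟨i, j⟩ = 1)))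

end GeometricType

/-! ### Oriented closed surfaces -/

/-- The loop `γ : [0,1] → ℂ ∖ {p}` turns `m` times around `p`, counted by a continuous choice `θ`
of the argument. -/
def HasWindingNumber (γ : ℝ → ℂ) (p : ℂ) (m : ℤ) : Prop :=
  ∃ θ : ℝ → ℝ, ContinuousOn θ (Icc 0 1) ∧
    (∀ t ∈ Icc (0 : ℝ) 1, γ t - p = (‖γ t - p‖ : ℂ) * Complex.exp (θ t * Complex.I)) ∧
    θ 1 - θ 0 = 2 * Real.pi * m

/-- A map of the plane (a homeomorphism near `p`) preserves the orientation at `p`: it preserves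
the winding numbers around `p` of small loops. -/
def PlaneOrientationPreservingAt (h : ℂ → ℂ) (p : ℂ) : Prop :=
  ∃ W ∈ 𝓝 p, ∀ γ : ℝ → ℂ, ContinuousOn γ (Icc 0 1) → γ 0 = γ 1 →
    (∀ t ∈ Icc (0 : ℝ) 1, γ t ∈ W ∧ γ t ≠ p) →
    ∀ m : ℤ, HasWindingNumber γ p m ↔ HasWindingNumber (h ∘ γ) (h p) m

/-- A closed oriented surface: a compact connected Hausdorff 2-manifold with an atlas whose
coordinate changes preserve the orientation of the plane. -/
class ClosedOrientedSurface (S : Type u) [TopologicalSpace S] [ChartedSpace ℂ S] : Prop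
    extends T2Space S, CompactSpace S, ConnectedSpace S where
  oriented : ∀ e ∈ atlas ℂ S, ∀ e' ∈ atlas ℂ S, ∀ x ∈ e.source ∩ e'.source,
    PlaneOrientationPreservingAt (e' ∘ e.symm) (e x)

/-- `f` (a homeomorphism near `x`) preserves the orientation at `x`, read in the charts. -/
def OrientationPreservingAt {X : Type u} {Y : Type v} [TopologicalSpace X] [ChartedSpace ℂ X]
    [TopologicalSpace Y] [ChartedSpace ℂ Y] (f : X → Y) (x : X) : Prop :=
  PlaneOrientationPreservingAt (chartAt ℂ (f x) ∘ f ∘ (chartAt ℂ x).symm) (chartAt ℂ x x)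

/-! ### Measured foliations -/

/-- Near `x`, `u = ± w + const`, that is `|du| = |dw|`. -/
def AgreesNear {S : Type u} [TopologicalSpace S] (u w : S → ℝ) (x : S) : Prop :=
  ∃ a : ℤˣ, ∃ c : ℝ, ∀ᶠ y in 𝓝 x, u y = ((a : ℤ) : ℝ) * w y + c

/-- A singular measured foliation, given by local transverse coordinates `(U, u)`, whose
transition rule is `u' = ± u + const`. The leaves are, locally, the level sets of `u`, and the
transverse measure is `|du|`: the measure of an arc in `U` is the total variation of `u` along it.
Regular points have a chart that takes the foliation to the horizontal foliation of `ℂ` with the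
measure `|dy|`. Singular points are `k`-prongs, `k ≥ 1`: in a chart `ψ` centred at the point, the
foliation is the one of `|Im d(ψ^{k/2})|` (`k = 1` is a spine, `k = 2` a marked regular point, as
is used for Anosov maps of the torus). -/
structure MeasuredFoliation (S : Type u) [TopologicalSpace S] where
  /-- the singular set -/
  sing : Set S
  sing_finite : sing.Finite
  /-- the transverse coordinates `(U, u)`; only the values of `u` on `U` matter -/
  coords : Set (Set S × (S → ℝ))
  isOpen_coord : ∀ c ∈ coords, IsOpen c.1
  disjoint_sing : ∀ c ∈ coords, Disjoint c.1 sing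
  cover : ∀ x ∉ sing, ∃ c ∈ coords, x ∈ c.1
  compat : ∀ c ∈ coords, ∀ d ∈ coords, ∀ x ∈ c.1 ∩ d.1, AgreesNear c.2 d.2 x
  regular : ∀ x ∉ sing, ∃ φ : OpenPartialHomeomorph S ℂ, x ∈ φ.source ∧
    ∀ c ∈ coords, ∀ y ∈ c.1 ∩ φ.source, AgreesNear c.2 (fun z => (φ z).im) y
  prong : ∀ p ∈ sing, ∃ k : ℕ, 1 ≤ k ∧ ∃ ψ : OpenPartialHomeomorph S ℂ, p ∈ ψ.source ∧ ψ p = 0 ∧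
    ∀ y ∈ ψ.source, y ∉ sing → ∃ w : S → ℂ,
      (∀ᶠ z in 𝓝 y, ContinuousAt w z ∧ w z ^ 2 = ψ z ^ k) ∧
      ∀ c ∈ coords, y ∈ c.1 → AgreesNear c.2 (fun z => (w z).im) y

namespace MeasuredFoliation

variable {S : Type u} [TopologicalSpace S]

/-- The path `γ : [0,1] → S` runs inside one leaf: the transverse coordinates are locally constant
along it. (A leaf that reaches a singularity comprises all the prongs there.) -/
def IsLeafPath (F : MeasuredFoliation S) (γ : ℝ → S) : Prop :=
  ∀ s ∈ Icc (0 : ℝ) 1, ∀ c ∈ F.coords, γ s ∈ c.1 →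
    ∀ᶠ s' in 𝓝[Icc 0 1] s, c.2 (γ s') = c.2 (γ s)

/-- `f` leaves the foliation invariant and `f_* μ = a μ`, where `(f_* μ)(α) = μ(f⁻¹(α))`. -/
def PushforwardEq (F : MeasuredFoliation S) (f : S ≃ₜ S) (a : ℝ) : Prop :=
  f '' F.sing = F.sing ∧ ∀ c ∈ F.coords, ∀ d ∈ F.coords, ∀ y ∈ d.1, f.symm y ∈ c.1 →
    AgreesNear (fun z => c.2 (f.symm z)) (fun z => a * d.2 z) y

/-- The two foliations are transverse, with the same singular set and the same singularity types:
near a regular point, a chart takes `Fs` to the horizontals with `|dy|` and `Fu` to the verticals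
with `|dx|`; near a singularity, a chart takes them to the two foliations of the standard `k`-prong,
`|Im d(z^{k/2})|` and `|Re d(z^{k/2})|`. -/
structure Transverse (Fs Fu : MeasuredFoliation S) : Prop where
  sing_eq : Fs.sing = Fu.sing
  regular : ∀ x ∉ Fs.sing, ∃ φ : OpenPartialHomeomorph S ℂ, x ∈ φ.source ∧
    (∀ c ∈ Fs.coords, ∀ y ∈ c.1 ∩ φ.source, AgreesNear c.2 (fun z => (φ z).im) y) ∧
    (∀ c ∈ Fu.coords, ∀ y ∈ c.1 ∩ φ.source, AgreesNear c.2 (fun z => (φ z).re) y)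
  prong : ∀ p ∈ Fs.sing, ∃ k : ℕ, 1 ≤ k ∧ ∃ ψ : OpenPartialHomeomorph S ℂ,
    p ∈ ψ.source ∧ ψ p = 0 ∧ ∀ y ∈ ψ.source, y ∉ Fs.sing → ∃ w : S → ℂ,
      (∀ᶠ z in 𝓝 y, ContinuousAt w z ∧ w z ^ 2 = ψ z ^ k) ∧
      (∀ c ∈ Fs.coords, y ∈ c.1 → AgreesNear c.2 (fun z => (w z).im) y) ∧
      (∀ c ∈ Fu.coords, y ∈ c.1 → AgreesNear c.2 (fun z => (w z).re) y)

end MeasuredFoliation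

/-- A (generalized) pseudo-Anosov homeomorphism, with its invariant measured foliations. -/
structure PseudoAnosov (S : Type u) [TopologicalSpace S] [ChartedSpace ℂ S] where
  /-- the homeomorphism -/
  map : S ≃ₜ S
  orientationPreserving : ∀ x, OrientationPreservingAt map x
  /-- the stable measured foliation -/
  Fs : MeasuredFoliation S
  /-- the unstable measured foliation -/
  Fu : MeasuredFoliation S
  transverse : Fs.Transverse Fu
  /-- the stretch factor -/
  stretch : ℝ
  one_lt_stretch : 1 < stretch
  pushforward_unstable : Fu.PushforwardEq map stretch
  pushforward_stable : Fs.PushforwardEq map stretch⁻¹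

/-! ### Geometric rectangles and Markov partitions -/

/-- The closed unit square. -/
def closedSquare : Set (ℝ × ℝ) := Icc 0 1 ×ˢ Icc 0 1

/-- The open unit square. -/
def openSquare : Set (ℝ × ℝ) := Ioo 0 1 ×ˢ Ioo 0 1

/-- A geometric rectangle, given by an orientation preserving parametrization `ρ` of the closed unit
square. Its vertical direction is the direction of increasing second coordinate, its horizontal
direction that of increasing first coordinate. (The rectangle with the opposite vertical direction
is parametrized by `ρ` composed with the rotation by `π` of the square.) -/
structure GeometricRectangle {S : Type u} [TopologicalSpace S] [ChartedSpace ℂ S]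
    (f : PseudoAnosov S) where
  /-- the parametrization; only its values on the closed unit square matter -/
  ρ : ℝ × ℝ → S
  continuousOn : ContinuousOn ρ closedSquare
  isOpenEmbedding : IsOpenEmbedding (openSquare.domRestrict ρ)
  orientationPreserving : ∀ z : ℂ, (z.re, z.im) ∈ openSquare →
    OrientationPreservingAt (fun w : ℂ => ρ (w.re, w.im)) z
  injOn_horizontal : ∀ t ∈ Icc (0 : ℝ) 1, InjOn (fun s => ρ (s, t)) (Icc 0 1)
  injOn_vertical : ∀ s ∈ Icc (0 : ℝ) 1, InjOn (fun t => ρ (s, t)) (Icc 0 1)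
  stable_horizontal : ∀ t ∈ Icc (0 : ℝ) 1, f.Fs.IsLeafPath fun s => ρ (s, t)
  unstable_vertical : ∀ s ∈ Icc (0 : ℝ) 1, f.Fu.IsLeafPath fun t => ρ (s, t)

section Markov

variable {S : Type u} [TopologicalSpace S] [ChartedSpace ℂ S] {f : PseudoAnosov S}

namespace GeometricRectangle

/-- The rectangle as a compact subset of the surface. -/
def carrier (R : GeometricRectangle f) : Set S := R.ρ '' closedSquare

/-- The interior of the rectangle, the image of the open square. -/
def interior (R : GeometricRectangle f) : Set S := R.ρ '' openSquare

/-- The horizontal (stable) interval at height `t`. -/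
def hInterval (R : GeometricRectangle f) (t : ℝ) : Set S := (fun s => R.ρ (s, t)) '' Icc 0 1

/-- The vertical (unstable) interval at abscissa `s`. -/
def vInterval (R : GeometricRectangle f) (s : ℝ) : Set S := (fun t => R.ρ (s, t)) '' Icc 0 1

/-- `H` is a horizontal sub-rectangle of `R`: through each interior point of `H`, the horizontal
intervals of `H` and of `R` coincide. -/
def IsHorizontalSub (H R : GeometricRectangle f) : Prop :=
  H.carrier ⊆ R.carrier ∧ H.interior ⊆ R.interior ∧
    ∀ z ∈ openSquare, ∀ w ∈ openSquare, H.ρ z = R.ρ w → H.hInterval z.2 = R.hInterval w.2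

/-- `V` is a vertical sub-rectangle of `R`. -/
def IsVerticalSub (V R : GeometricRectangle f) : Prop :=
  V.carrier ⊆ R.carrier ∧ V.interior ⊆ R.interior ∧
    ∀ z ∈ openSquare, ∀ w ∈ openSquare, V.ρ z = R.ρ w → V.vInterval z.1 = R.vInterval w.1

/-- Inside `R`, the horizontal and the vertical directions of `H` are those of `R`. -/
def SameDirections (H R : GeometricRectangle f) : Prop :=
  ∀ z ∈ openSquare, ∀ z' ∈ openSquare, ∀ w ∈ openSquare, ∀ w' ∈ openSquare,
    H.ρ z = R.ρ w → H.ρ z' = R.ρ w' → (z.1 < z'.1 ↔ w.1 < w'.1) ∧ (z.2 < z'.2 ↔ w.2 < w'.2)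

end GeometricRectangle

/-- The connected components of a subset `A`. -/
def componentsOf (A : Set S) : Set (Set S) := {C | ∃ x ∈ A, C = connectedComponentIn A x}

/-- The family of geometric rectangles `R` is a geometric Markov partition for `f`. The rectangle
obtained as the closure of a component `C` is the one whose interior is `C`. -/
structure IsGeometricMarkovPartition (f : PseudoAnosov S) {n : ℕ}
    (R : Fin n → GeometricRectangle f) : Prop where
  cover : ⋃ i, (R i).carrier = univ
  disjoint : ∀ i j, i ≠ j → Disjoint (R i).interior (R j).interior
  horizontal : ∀ i j, ∀ C ∈ componentsOf ((R i).interior ∩ f.map ⁻¹' (R j).interior),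
    ∃ H : GeometricRectangle f, H.interior = C ∧ H.carrier = closure C ∧ H.IsHorizontalSub (R i)
  vertical : ∀ i j, ∀ C ∈ componentsOf (f.map '' (R i).interior ∩ (R j).interior),
    ∃ V : GeometricRectangle f, V.interior = C ∧ V.carrier = closure C ∧ V.IsVerticalSub (R j)

/-- `H i j` is (the interior of) the `j`-th horizontal sub-rectangle of `R i`, where these are
counted from bottom to top. -/
def IsHorizontalLabelling (f : PseudoAnosov S) {n : ℕ} (R : Fin n → GeometricRectangle f)
    (h : Fin n → ℕ) (H : ∀ i, Fin (h i) → Set S) : Prop :=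
  (∀ i, range (H i) = ⋃ k, componentsOf ((R i).interior ∩ f.map ⁻¹' (R k).interior)) ∧
  ∀ i, ∀ j j' : Fin (h i), j < j' → ∀ z ∈ openSquare, ∀ z' ∈ openSquare,
    (R i).ρ z ∈ H i j → (R i).ρ z' ∈ H i j' → z.2 < z'.2

/-- `V k l` is (the interior of) the `l`-th vertical sub-rectangle of `R k`, where these are
counted from left to right. -/
def IsVerticalLabelling (f : PseudoAnosov S) {n : ℕ} (R : Fin n → GeometricRectangle f)
    (v : Fin n → ℕ) (V : ∀ k, Fin (v k) → Set S) : Prop :=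
  (∀ k, range (V k) = ⋃ i, componentsOf (f.map '' (R i).interior ∩ (R k).interior)) ∧
  ∀ k, ∀ l l' : Fin (v k), l < l' → ∀ z ∈ openSquare, ∀ z' ∈ openSquare,
    (R k).ρ z ∈ V k l → (R k).ρ z' ∈ V k l' → z.1 < z'.1

/-- On the subset `A` of the rectangle `R`, with image in the rectangle `R'`, the homeomorphism
carries the vertical direction of `R` to that of `R'`. -/
def PreservesVerticalOn (f : PseudoAnosov S) (R R' : GeometricRectangle f) (A : Set S) : Prop :=
  ∀ s t t' : ℝ, (s, t) ∈ openSquare → (s, t') ∈ openSquare → t < t' →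
    R.ρ (s, t) ∈ A → R.ρ (s, t') ∈ A → ∀ w ∈ openSquare, ∀ w' ∈ openSquare,
      R'.ρ w = f.map (R.ρ (s, t)) → R'.ρ w' = f.map (R.ρ (s, t')) → w.2 < w'.2

/-- `T` is the geometric type of the pair `(f, R)`. -/
def HasGeometricType (f : PseudoAnosov S) (T : GeometricType)
    (R : Fin T.n → GeometricRectangle f) : Prop :=
  ∃ (H : ∀ i, Fin (T.h i) → Set S) (V : ∀ k, Fin (T.v k) → Set S),
    IsHorizontalLabelling f R T.h H ∧ IsVerticalLabelling f R T.v V ∧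
    (∀ x : T.HLabel, f.map '' H x.1 x.2 = V (T.ρ x).1 (T.ρ x).2) ∧
    ∀ x : T.HLabel, T.ε x = 1 ↔ PreservesVerticalOn f (R x.1) (R (T.ρ x).1) (H x.1 x.2)

/-- The incidence matrix of `(f, R)`: the number of horizontal sub-rectangles of `R i` that `f`
sends to vertical sub-rectangles of `R k`. -/
noncomputable def partitionIncidence (f : PseudoAnosov S) {n : ℕ}
    (R : Fin n → GeometricRectangle f) : Matrix (Fin n) (Fin n) ℕ :=
  fun i k => (componentsOf ((R i).interior ∩ f.map ⁻¹' (R k).interior)).ncard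

/-- `B` is the horizontal refinement of the partition `R` (with geometric type `T`): its rectangles
are the horizontal sub-rectangles `H^i_j` of `(f, R)`, with the directions of `R i`, enumerated in
the lexicographic order of the labels `(i,j)`. -/
def IsHorizontalRefinement (f : PseudoAnosov S) (T : GeometricType)
    (R : Fin T.n → GeometricRectangle f)
    (B : Fin T.binaryRefinement.n → GeometricRectangle f) : Prop :=
  ∃ H : ∀ i, Fin (T.h i) → Set S, IsHorizontalLabelling f R T.h H ∧
    ∀ x : T.HLabel, (B (T.lex x)).interior = H x.1 x.2 ∧
      (B (T.lex x)).carrier = closure (H x.1 x.2) ∧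
      (B (T.lex x)).IsHorizontalSub (R x.1) ∧ (B (T.lex x)).SameDirections (R x.1)

end Markov

/-- `T` is in the pseudo-Anosov class: it is the geometric type of some pair `(f, R)`. -/
def GeometricType.IsPseudoAnosovType (T : GeometricType) : Prop :=
  ∃ (S : Type u) (_ : TopologicalSpace S) (_ : ChartedSpace ℂ S) (_ : ClosedOrientedSurface S)
    (f : PseudoAnosov S) (R : Fin T.n → GeometricRectangle f),
    IsGeometricMarkovPartition f R ∧ HasGeometricType f T R

/-- A matrix is binary if all its coefficients are `0` or `1`. -/
def IsBinary {n : ℕ} (A : Matrix (Fin n) (Fin n) ℕ) : Prop := ∀ i j, A i j = 0 ∨ A i j = 1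

/-- `T` is symbolically presentable: it is in the pseudo-Anosov class and its incidence matrix is
binary. -/
def GeometricType.IsSymbolicallyPresentable (T : GeometricType) : Prop :=
  GeometricType.IsPseudoAnosovType.{u} T ∧ IsBinary T.incidence

/-!
The binary refinement of a geometric type is the geometric type of the horizontal refinement.

The geometry rests on one fact: a homeomorphism that respects the stable foliation acts on
horizontal sub-rectangles as a map of heights. Near a regular interior point of a rectangle, a chart
adapted to both foliations separates heights from abscissae
(`GeometricRectangle.exists_coord_separating`), so a path in a stable leaf that stays in the interior
of a rectangle has locally constant height; as there are only finitely many singular points, its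
height is constant (`GeometricRectangle.height_eq_of_isLeafPath`). Sub-rectangles in the sense of
Markov partitions are honest strips (`IsBox.exists_horizontal_strip`, `IsBox.exists_vertical_strip`).
Since `f` maps the horizontal sub-rectangle `H x` of `R i` onto a vertical sub-rectangle of `R k`,
and both `f` and its inverse respect stable leaves, the height of the image is a strictly monotone
function of the height with range `(0, 1)`, increasing exactly if `ε x = 1`
(`IsMarkovLabelling.exists_height`).

Hence `f` maps `H x` across every horizontal sub-rectangle `H y` of `R k`, in a single component: the
part of `H x` sent into `H y` is a horizontal strip, and the part of `H y` covered by `f (H x)` is the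
intersection of a vertical and a horizontal strip of `R k`. All other intersections are empty. This
gives the Markov property and the binary incidence matrix at once. The order of the strips in `H x`
is that of the `H y` in `R k` if `ε x = 1` and the opposite one otherwise, which is the rule for
`ρ'`; the vertical strips in `H y` come in the order of the vertical sub-rectangles of `R k`. The
horizontal sub-rectangles themselves become rectangles by restricting the parametrization of `R i`
(`GeometricRectangle.restrict`); an affine map with positive factors keeps winding numbers, so this
preserves the orientation. They cover the surface by a density argument
(`IsHorizontalLabelling.iUnion_closure`).

On codes, the refinement is a primitive recursive rewriting of lists
(`GeometricType.primrec_refineCode`, `GeometricType.refineCode_code`).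
-/

/-! ### Computability of the binary refinement on codes -/

/-- The entries of a flattened list of lists, indexed by a row and a position in the row. -/
theorem List.getElem?_flatten_sum_add {α : Type*} (LL : List (List α)) (k j : ℕ)
    (hj : j < (LL[k]?.getD []).length) :
    LL.flatten[(∑ i ∈ Finset.range k, (LL[i]?.getD []).length) + j]? = (LL[k]?.getD [])[j]? := by
  induction LL generalizing k with
  | nil => simp at hj
  | cons a LL ih =>
    cases k with
    | zero =>
      have : j < a.length := by simpa using hj
      simp [List.getElem?_append_left this]
    | succ k =>
      have := ih k (by simpa using hj)
      rw [Finset.sum_range_succ']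
      simp only [List.getElem?_cons_succ, List.getElem?_cons_zero, List.flatten_cons,
        Option.getD_some] at this ⊢
      rw [List.getElem?_append_right (by omega), ← this]
      congr 1
      omega

/-- Listing a function on labels `(i, j)` in lexicographic order is listing it row by row. -/
theorem List.ofFn_finSigmaFinEquiv_symm {α : Type*} {n : ℕ} {h : Fin n → ℕ}
    (g : (Σ i, Fin (h i)) → α) :
    (List.ofFn fun a => g (finSigmaFinEquiv.symm a)) =
      (List.ofFn fun i => List.ofFn fun j => g ⟨i, j⟩).flatten := by
  have hlen : ∀ i : Fin n,
      ((List.ofFn fun i => List.ofFn fun j => g ⟨i, j⟩)[(i : ℕ)]?.getD []).length = h i := by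
    intro i; simp
  apply List.ext_getElem?
  intro a
  by_cases ha : a < ∑ i, h i
  · obtain ⟨x, hx⟩ := (finSigmaFinEquiv (n := h)).surjective ⟨a, ha⟩
    have hval : a = (finSigmaFinEquiv x : ℕ) := by rw [hx]
    have hsum : ∑ i : Fin x.1, h (Fin.castLE x.1.2.le i) = ∑ i ∈ Finset.range x.1,
        ((List.ofFn fun i => List.ofFn fun j => g ⟨i, j⟩)[i]?.getD []).length := by
      rw [Finset.sum_range]
      exact Finset.sum_congr rfl fun i _ => (hlen (Fin.castLE x.1.2.le i)).symm
    have hl : (List.ofFn fun a => g (finSigmaFinEquiv.symm a))[a]? = some (g x) := by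
      rw [List.getElem?_ofFn, dif_pos ha, ← hx, Equiv.symm_apply_apply]
    rw [hl, hval, finSigmaFinEquiv_apply, hsum, List.getElem?_flatten_sum_add _ _ _
      (by rw [hlen]; exact x.2.2)]
    simp
  · rw [List.getElem?_eq_none (by simpa using ha), List.getElem?_eq_none]
    simpa [List.length_flatten, List.map_ofFn, Function.comp_def, List.sum_ofFn] using ha

namespace GeometricType

/-- The number of entries of row `k` of a code, `h_k` for the code of a geometric type. -/
def codeRowLength (L : List (ℕ × List (ℕ × ℕ × Bool))) (k : ℕ) : ℕ :=
  (L[k]?.getD (0, [])).2.length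

/-- The lexicographic rank `∑_{i < k} h_i + m`, read off a code. -/
def codeRank (L : List (ℕ × List (ℕ × ℕ × Bool))) (k m : ℕ) : ℕ :=
  ((List.range k).map (codeRowLength L)).foldr (· + ·) m

/-- The binary refinement as a map of codes: the entry `(k, l, e)` in a row with first component `v`
becomes a row with first component `v` and an entry for each position in row `k`. -/
def refineCode (L : List (ℕ × List (ℕ × ℕ × Bool))) : List (ℕ × List (ℕ × ℕ × Bool)) :=
  L.flatMap fun p => p.2.map fun q => (p.1, (List.range (codeRowLength L q.1)).map fun j =>
    (codeRank L q.1 (bif q.2.2 then j else codeRowLength L q.1 - (j + 1)), q.2.1, q.2.2))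

theorem primrec_codeRowLength : Primrec₂ codeRowLength := by
  have hget : Primrec₂ fun (L : List (ℕ × List (ℕ × ℕ × Bool))) (k : ℕ) => L[k]?.getD (0, []) :=
    Primrec.option_getD.comp₂ Primrec.list_getElem? (Primrec₂.const (0, []))
  exact Primrec.list_length.comp (Primrec.snd.comp hget)

theorem primrec_refineCode : Primrec refineCode := by
  have hrank : Primrec fun x : List (ℕ × List (ℕ × ℕ × Bool)) × ℕ × ℕ =>
      codeRank x.1 x.2.1 x.2.2 := by
    have hk : Primrec fun x : List (ℕ × List (ℕ × ℕ × Bool)) × ℕ × ℕ => List.range x.2.1 :=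
      Primrec.list_range.comp (Primrec.fst.comp Primrec.snd)
    have hm : Primrec fun x : List (ℕ × List (ℕ × ℕ × Bool)) × ℕ × ℕ =>
        (List.range x.2.1).map (codeRowLength x.1) :=
      Primrec.list_map hk
        (primrec_codeRowLength.comp₂ (Primrec.fst.comp₂ Primrec₂.left) Primrec₂.right)
    have hadd : Primrec₂ fun (_ : List (ℕ × List (ℕ × ℕ × Bool)) × ℕ × ℕ) (y : ℕ × ℕ) =>
        y.1 + y.2 :=
      Primrec.nat_add.comp₂ (Primrec.fst.comp₂ Primrec₂.right) (Primrec.snd.comp₂ Primrec₂.right)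
    exact Primrec.list_foldr hm (Primrec.snd.comp Primrec.snd) hadd
  have hrow : Primrec fun x : List (ℕ × List (ℕ × ℕ × Bool)) × ℕ × List (ℕ × ℕ × Bool) =>
      x.2.2 := Primrec.snd.comp Primrec.snd
  refine Primrec.list_flatMap Primrec.id (Primrec.list_map hrow (Primrec.pair
    (Primrec.fst.comp (Primrec.snd.comp Primrec.fst)) ?_))
  have hL : Primrec fun x : (List (ℕ × List (ℕ × ℕ × Bool)) × ℕ × List (ℕ × ℕ × Bool)) ×
      ℕ × ℕ × Bool => x.1.1 := Primrec.fst.comp Primrec.fst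
  have hlen : Primrec fun x : (List (ℕ × List (ℕ × ℕ × Bool)) × ℕ × List (ℕ × ℕ × Bool)) ×
      ℕ × ℕ × Bool => codeRowLength x.1.1 x.2.1 :=
    primrec_codeRowLength.comp hL (Primrec.fst.comp Primrec.snd)
  refine Primrec.list_map (Primrec.list_range.comp hlen) ?_
  have hq : Primrec fun y : ((List (ℕ × List (ℕ × ℕ × Bool)) × ℕ × List (ℕ × ℕ × Bool)) ×
      ℕ × ℕ × Bool) × ℕ => y.1.2 := Primrec.snd.comp Primrec.fst
  refine Primrec.pair (hrank.comp (Primrec.pair (hL.comp Primrec.fst)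
    (Primrec.pair (Primrec.fst.comp hq) (Primrec.cond ?_ Primrec.snd ?_))))
    (Primrec.snd.comp hq)
  · exact Primrec.snd.comp (Primrec.snd.comp hq)
  · exact Primrec.nat_sub.comp (hlen.comp Primrec.fst) (Primrec.succ.comp Primrec.snd)

theorem codeRowLength_code (T : GeometricType) (k : Fin T.n) :
    codeRowLength T.code k = T.h k := by
  simp [codeRowLength, code]

theorem codeRank_code (T : GeometricType) (x : T.HLabel) :
    codeRank T.code x.1 x.2 = T.lex x := by
  have hfold : ∀ (l : List ℕ) (m : ℕ), l.foldr (· + ·) m = l.sum + m := by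
    intro l m
    induction l with
    | nil => simp
    | cons a l ih => simp [ih, add_assoc]
  rw [codeRank, hfold, lex, finSigmaFinEquiv_apply]
  congr 1
  have hsum : ∀ f : ℕ → ℕ, ((List.range x.1).map f).sum = ∑ i ∈ Finset.range x.1, f i :=
    fun f => rfl
  rw [hsum, Finset.sum_range]
  exact Finset.sum_congr rfl fun i _ => codeRowLength_code T (Fin.castLE x.1.2.le i)

theorem refineCode_code (T : GeometricType) : refineCode T.code = T.binaryRefinement.code := by
  refine Eq.trans ?_ (List.ofFn_finSigmaFinEquiv_symm fun x : T.HLabel =>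
    (T.v x.1, List.ofFn fun j : Fin (T.h (T.ρ x).1) =>
      ((T.lex ⟨(T.ρ x).1, flip (T.ε x) j⟩ : ℕ), ((T.ρ x).2 : ℕ), decide (T.ε x = 1)))).symm
  rw [refineCode, List.flatMap]
  congr 1
  conv_lhs => arg 2; rw [code]
  rw [List.map_ofFn]
  congr 1
  funext i
  simp only [Function.comp, List.map_ofFn]
  congr 1
  funext j
  simp only [Function.comp]
  congr 1
  rw [codeRowLength_code]
  apply List.ext_getElem
  · simp
  · intro a h1 h2
    have ha : a < T.h (T.ρ ⟨i, j⟩).1 := by simpa using h1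
    simp only [List.getElem_map, List.getElem_range, List.getElem_ofFn, Prod.mk.injEq, and_true]
    rw [← codeRank_code]
    congr 1
    by_cases he : T.ε ⟨i, j⟩ = 1
    · simp [he, flip]
    · simp [he, flip, Fin.val_rev]

end GeometricType

/-! ### Continuous boxes in a Hausdorff space -/

/-- The topological part of the notion of rectangle: a continuous map of the closed square, an open
embedding on the open square, injective on every horizontal and every vertical segment. -/
structure IsBox {S : Type u} [TopologicalSpace S] (ρ : ℝ × ℝ → S) : Prop where
  continuousOn : ContinuousOn ρ closedSquare
  isOpenEmbedding : IsOpenEmbedding (openSquare.domRestrict ρ)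
  injOn_horizontal : ∀ t ∈ Icc (0 : ℝ) 1, InjOn (fun s => ρ (s, t)) (Icc 0 1)
  injOn_vertical : ∀ s ∈ Icc (0 : ℝ) 1, InjOn (fun t => ρ (s, t)) (Icc 0 1)

/-- The coordinates, in the open square, of a point of the interior of a box. -/
noncomputable def boxCoord {S : Type u} (ρ : ℝ × ℝ → S) : S → ℝ × ℝ :=
  Function.invFunOn ρ openSquare

theorem isOpen_openSquare : IsOpen openSquare := isOpen_Ioo.prod isOpen_Ioo

theorem openSquare_subset_closedSquare : openSquare ⊆ closedSquare :=
  prod_mono Ioo_subset_Icc_self Ioo_subset_Icc_self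

theorem closure_openSquare : closure openSquare = closedSquare := by
  rw [openSquare, closedSquare, closure_prod_eq, closure_Ioo zero_ne_one]

theorem swap_mem_openSquare {z : ℝ × ℝ} : z.swap ∈ openSquare ↔ z ∈ openSquare := and_comm

theorem swap_mem_closedSquare {z : ℝ × ℝ} : z.swap ∈ closedSquare ↔ z ∈ closedSquare := and_comm

theorem Ioo_prod_Ioo_subset_openSquare {a b c d : ℝ} (ha : 0 ≤ a) (hb : b ≤ 1) (hc : 0 ≤ c)
    (hd : d ≤ 1) : Ioo a b ×ˢ Ioo c d ⊆ openSquare :=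
  prod_mono (Ioo_subset_Ioo ha hb) (Ioo_subset_Ioo hc hd)

theorem Icc_prod_Icc_subset_closedSquare {a b c d : ℝ} (ha : 0 ≤ a) (hb : b ≤ 1) (hc : 0 ≤ c)
    (hd : d ≤ 1) : Icc a b ×ˢ Icc c d ⊆ closedSquare :=
  prod_mono (Icc_subset_Icc ha hb) (Icc_subset_Icc hc hd)

theorem boxCoord_mem {S : Type u} {ρ : ℝ × ℝ → S} {x : S} (hx : x ∈ ρ '' openSquare) :
    boxCoord ρ x ∈ openSquare :=
  Function.invFunOn_mem hx

theorem apply_boxCoord {S : Type u} {ρ : ℝ × ℝ → S} {x : S} (hx : x ∈ ρ '' openSquare) :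
    ρ (boxCoord ρ x) = x :=
  Function.invFunOn_eq hx

theorem image_comp_swap {S : Type u} (ρ : ℝ × ℝ → S) (A B : Set ℝ) :
    (ρ ∘ Prod.swap) '' (A ×ˢ B) = ρ '' (B ×ˢ A) := by
  rw [image_comp, image_swap_prod]

theorem exists_Ioo_of_isOpen_of_isPreconnected {J : Set ℝ} (hJ : IsOpen J)
    (hJc : IsPreconnected J) (hne : J.Nonempty) {a b : ℝ} (hsub : J ⊆ Ioo a b) :
    ∃ c d, a ≤ c ∧ c < d ∧ d ≤ b ∧ J = Ioo c d := by
  have hb : BddBelow J := bddBelow_Ioo.mono hsub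
  have ha : BddAbove J := bddAbove_Ioo.mono hsub
  have hJ' : J = Ioo (sInf J) (sSup J) := by
    apply subset_antisymm
    · intro x hx
      obtain ⟨ε, hε, hball⟩ := Metric.isOpen_iff.1 hJ x hx
      have h1 : x - ε / 2 ∈ J := hball (by rw [Metric.mem_ball, Real.dist_eq]; grind)
      have h2 : x + ε / 2 ∈ J := hball (by rw [Metric.mem_ball, Real.dist_eq]; grind)
      exact ⟨by linarith [csInf_le hb h1], by linarith [le_csSup ha h2]⟩
    · exact IsConnected.Ioo_csInf_csSup_subset ⟨hne, hJc⟩ hb ha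
  obtain ⟨x, hx⟩ := hne
  refine ⟨sInf J, sSup J, ?_, ?_, ?_, hJ'⟩
  · exact le_csInf ⟨x, hx⟩ fun y hy => (hsub hy).1.le
  · rw [hJ'] at hx
    exact hx.1.trans hx.2
  · exact csSup_le ⟨x, hx⟩ fun y hy => (hsub hy).2.le

namespace IsBox

variable {S : Type u} [TopologicalSpace S] {ρ σ : ℝ × ℝ → S}

theorem injOn (hρ : IsBox ρ) : InjOn ρ openSquare :=
  injOn_iff_injective.2 hρ.isOpenEmbedding.injective

theorem boxCoord_apply (hρ : IsBox ρ) {z : ℝ × ℝ} (hz : z ∈ openSquare) :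
    boxCoord ρ (ρ z) = z :=
  hρ.injOn.leftInvOn_invFunOn hz

theorem isOpen_image (hρ : IsBox ρ) {U : Set (ℝ × ℝ)} (hU : IsOpen U) (hUs : U ⊆ openSquare) :
    IsOpen (ρ '' U) := by
  have := hρ.isOpenEmbedding.isOpenMap _ (hU.preimage (continuous_subtype_val (p := (· ∈ openSquare))))
  convert this using 1
  ext x
  constructor
  · rintro ⟨z, hz, rfl⟩
    exact ⟨⟨z, hUs hz⟩, hz, rfl⟩
  · rintro ⟨z, hz, rfl⟩
    exact ⟨z, hz, rfl⟩

theorem continuousOn_boxCoord (hρ : IsBox ρ) : ContinuousOn (boxCoord ρ) (ρ '' openSquare) := by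
  intro x hx
  obtain ⟨z, hz, rfl⟩ := hx
  apply ContinuousAt.continuousWithinAt
  rw [ContinuousAt, hρ.boxCoord_apply hz]
  intro U hU
  rw [mem_map]
  obtain ⟨V, hVU, hV, hzV⟩ := mem_nhds_iff.1 (inter_mem hU (isOpen_openSquare.mem_nhds hz))
  refine mem_of_superset ((hρ.isOpen_image hV fun y hy => (hVU hy).2).mem_nhds ⟨z, hzV, rfl⟩) ?_
  rintro _ ⟨y, hy, rfl⟩
  rw [mem_preimage, hρ.boxCoord_apply (hVU hy).2]
  exact (hVU hy).1

theorem continuousAt (hρ : IsBox ρ) {z : ℝ × ℝ} (hz : z ∈ openSquare) : ContinuousAt ρ z :=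
  hρ.continuousOn.continuousAt
    (mem_of_superset (isOpen_openSquare.mem_nhds hz) openSquare_subset_closedSquare)

theorem continuousAt_boxCoord (hρ : IsBox ρ) {x : S} (hx : x ∈ ρ '' openSquare) :
    ContinuousAt (boxCoord ρ) x :=
  hρ.continuousOn_boxCoord.continuousAt
    ((hρ.isOpen_image isOpen_openSquare subset_rfl).mem_nhds hx)

/-- Boundary points of the square are not sent into the interior of the box. -/
theorem eq_of_mem_openSquare (hρ : IsBox ρ) {z w : ℝ × ℝ} (hz : z ∈ closedSquare)
    (hw : w ∈ openSquare) (h : ρ z = ρ w) : z = w := by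
  have hne : (𝓝[openSquare] z).NeBot := by
    rw [← mem_closure_iff_nhdsWithin_neBot, closure_openSquare]
    exact hz
  have h1 : Tendsto ρ (𝓝[openSquare] z) (𝓝 (ρ w)) := by
    rw [← h]
    exact (hρ.continuousOn z hz).mono openSquare_subset_closedSquare
  have h2 : Tendsto (boxCoord ρ ∘ ρ) (𝓝[openSquare] z) (𝓝 w) := by
    have := (hρ.continuousAt_boxCoord ⟨w, hw, rfl⟩).tendsto
    rw [hρ.boxCoord_apply hw] at this
    exact this.comp h1
  have h3 : Tendsto (boxCoord ρ ∘ ρ) (𝓝[openSquare] z) (𝓝 z) := by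
    have : Tendsto id (𝓝[openSquare] z) (𝓝 z) := tendsto_id.mono_left nhdsWithin_le_nhds
    refine this.congr' ?_
    filter_upwards [self_mem_nhdsWithin] with y hy
    exact (hρ.boxCoord_apply hy).symm
  exact tendsto_nhds_unique h3 h2

theorem swap (hρ : IsBox ρ) : IsBox (ρ ∘ Prod.swap) where
  continuousOn := hρ.continuousOn.comp continuous_swap.continuousOn
    fun _ hz => swap_mem_closedSquare.2 hz
  isOpenEmbedding := by
    let e : openSquare ≃ₜ openSquare := (Homeomorph.prodComm ℝ ℝ).subtype
      fun z => (swap_mem_openSquare (z := z)).symm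
    exact hρ.isOpenEmbedding.comp e.isOpenEmbedding
  injOn_horizontal := hρ.injOn_vertical
  injOn_vertical := hρ.injOn_horizontal

/-- The closure of an open sub-box is the closed sub-box. -/
theorem closure_image [T2Space S] (hρ : IsBox ρ) {a b c d : ℝ} (ha : 0 ≤ a) (hab : a < b)
    (hb : b ≤ 1) (hc : 0 ≤ c) (hcd : c < d) (hd : d ≤ 1) :
    closure (ρ '' (Ioo a b ×ˢ Ioo c d)) = ρ '' (Icc a b ×ˢ Icc c d) := by
  have hcont := hρ.continuousOn.mono (Icc_prod_Icc_subset_closedSquare ha hb hc hd)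
  apply subset_antisymm
  · exact closure_minimal
      (image_mono (prod_mono Ioo_subset_Icc_self Ioo_subset_Icc_self))
      ((isCompact_Icc.prod isCompact_Icc).image_of_continuousOn hcont).isClosed
  · have hcl : closure (Ioo a b ×ˢ Ioo c d) = Icc a b ×ˢ Icc c d := by
      rw [closure_prod_eq, closure_Ioo hab.ne, closure_Ioo hcd.ne]
    rw [← hcl] at hcont ⊢
    exact hcont.image_closure

theorem isPreconnected_image (hρ : IsBox ρ) {a b c d : ℝ} (ha : 0 ≤ a)
    (hb : b ≤ 1) (hc : 0 ≤ c) (hd : d ≤ 1) : IsPreconnected (ρ '' (Ioo a b ×ˢ Ioo c d)) :=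
  (isPreconnected_Ioo.prod isPreconnected_Ioo).image ρ (hρ.continuousOn.mono
    ((Ioo_prod_Ioo_subset_openSquare ha hb hc hd).trans openSquare_subset_closedSquare))

/-- If the box `ρ` lies in the box `σ` and its horizontal segment at height `t` is a full horizontal
segment of `σ`, then the open segment is the full open segment of `σ`. The abscissae in `σ` of
the open segment form a connected set, and by compactness this has `0` and `1` in its closure. -/
theorem mem_image_of_hSegment_eq [T2Space S] (hρ : IsBox ρ) (hσ : IsBox σ)
    (hsub : ρ '' openSquare ⊆ σ '' openSquare) {z w : ℝ × ℝ} (hz : z ∈ openSquare)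
    (hw : w ∈ openSquare)
    (hseg : (fun s => ρ (s, z.2)) '' Icc 0 1 = (fun s => σ (s, w.2)) '' Icc 0 1)
    {x : ℝ} (hx : x ∈ Ioo (0 : ℝ) 1) : σ (x, w.2) ∈ ρ '' openSquare := by
  have hmem : ∀ s ∈ Ioo (0 : ℝ) 1, ρ (s, z.2) ∈ σ '' openSquare :=
    fun s hs => hsub ⟨(s, z.2), ⟨hs, hz.2⟩, rfl⟩
  have hIcc : ∀ s ∈ Icc (0 : ℝ) 1, (s, w.2) ∈ closedSquare :=
    fun s hs => ⟨hs, Ioo_subset_Icc_self hw.2⟩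
  -- `P` is the set of abscissae in `σ` of the open segment of `ρ`
  set P : Set ℝ := (fun s => (boxCoord σ (ρ (s, z.2))).1) '' Ioo 0 1 with hP
  have hcontρ : ContinuousOn (fun s => ρ (s, z.2)) (Icc 0 1) :=
    hρ.continuousOn.comp (by fun_prop) fun s hs => ⟨hs, Ioo_subset_Icc_self hz.2⟩
  have hPconn : IsPreconnected P := by
    refine isPreconnected_Ioo.image _ (continuous_fst.comp_continuousOn ?_)
    exact hσ.continuousOn_boxCoord.comp (hcontρ.mono Ioo_subset_Icc_self) hmem
  have hheight : ∀ s ∈ Ioo (0 : ℝ) 1, boxCoord σ (ρ (s, z.2)) =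
      ((boxCoord σ (ρ (s, z.2))).1, w.2) := by
    intro s hs
    have : ρ (s, z.2) ∈ (fun s => σ (s, w.2)) '' Icc 0 1 :=
      hseg ▸ ⟨s, Ioo_subset_Icc_self hs, rfl⟩
    obtain ⟨s', hs', h⟩ := this
    have := hσ.eq_of_mem_openSquare (hIcc s' hs') (boxCoord_mem (hmem s hs))
      (h.trans (apply_boxCoord (hmem s hs)).symm)
    rw [← this]
  have hPsub : ∀ p ∈ P, p ∈ Ioo (0 : ℝ) 1 ∧ σ (p, w.2) ∈ ρ '' openSquare := by
    rintro _ ⟨s, hs, rfl⟩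
    refine ⟨(boxCoord_mem (hmem s hs)).1, ?_⟩
    dsimp only
    rw [← hheight s hs, apply_boxCoord (hmem s hs)]
    exact ⟨(s, z.2), ⟨hs, hz.2⟩, rfl⟩
  have hPcl : closure P ⊆ Icc 0 1 :=
    closure_minimal (fun p hp => Ioo_subset_Icc_self (hPsub p hp).1) isClosed_Icc
  have hfull : Icc (0 : ℝ) 1 ⊆ closure P := by
    intro y hy
    have hσc : ContinuousOn (fun s => σ (s, w.2)) (closure P) :=
      hσ.continuousOn.comp (by fun_prop) fun s hs => hIcc s (hPcl hs)
    have hclosed : IsClosed ((fun s => σ (s, w.2)) '' closure P) :=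
      ((isCompact_Icc.of_isClosed_subset isClosed_closure hPcl).image_of_continuousOn hσc).isClosed
    have h1 : (fun s => ρ (s, z.2)) '' Ioo 0 1 ⊆ (fun s => σ (s, w.2)) '' closure P := by
      rintro _ ⟨s, hs, rfl⟩
      refine ⟨(boxCoord σ (ρ (s, z.2))).1, subset_closure ⟨s, hs, rfl⟩, ?_⟩
      dsimp only
      rw [← hheight s hs, apply_boxCoord (hmem s hs)]
    have h2 : (fun s => ρ (s, z.2)) '' Icc 0 1 ⊆ closure ((fun s => ρ (s, z.2)) '' Ioo 0 1) := by
      rw [← closure_Ioo (zero_ne_one (α := ℝ))] at hcontρ ⊢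
      exact hcontρ.image_closure
    have hy' : σ (y, w.2) ∈ (fun s => ρ (s, z.2)) '' Icc 0 1 := hseg ▸ ⟨y, hy, rfl⟩
    obtain ⟨y', hy'P, h⟩ := closure_minimal h1 hclosed (h2 hy')
    rwa [← hσ.injOn_horizontal w.2 (Ioo_subset_Icc_self hw.2) (hPcl hy'P) hy h]
  obtain ⟨p, hp, hpP⟩ := mem_closure_iff.1 (hfull (left_mem_Icc.2 zero_le_one)) (Iio x)
    isOpen_Iio hx.1
  obtain ⟨q, hq, hqP⟩ := mem_closure_iff.1 (hfull (right_mem_Icc.2 zero_le_one)) (Ioi x)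
    isOpen_Ioi hx.2
  exact (hPsub x (hPconn.ordConnected.out hpP hqP ⟨hp.le, hq.le⟩)).2

/-- A box in `σ` whose horizontal segments are horizontal segments of `σ` is a horizontal strip. -/
theorem exists_horizontal_strip [T2Space S] (hρ : IsBox ρ) (hσ : IsBox σ)
    (hsub : ρ '' openSquare ⊆ σ '' openSquare)
    (hseg : ∀ z ∈ openSquare, ∀ w ∈ openSquare, ρ z = σ w →
      (fun s => ρ (s, z.2)) '' Icc 0 1 = (fun s => σ (s, w.2)) '' Icc 0 1) :
    ∃ a b, 0 ≤ a ∧ a < b ∧ b ≤ 1 ∧ ρ '' openSquare = σ '' (Ioo 0 1 ×ˢ Ioo a b) := by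
  have hcont : ContinuousOn (boxCoord σ) (ρ '' openSquare) := hσ.continuousOn_boxCoord.mono hsub
  have hopen : IsOpen (ρ '' openSquare) := hρ.isOpen_image isOpen_openSquare subset_rfl
  have hU : IsOpen (boxCoord σ '' (ρ '' openSquare)) := by
    have : boxCoord σ '' (ρ '' openSquare) = openSquare ∩ σ ⁻¹' (ρ '' openSquare) := by
      ext w
      constructor
      · rintro ⟨x, hx, rfl⟩
        refine ⟨boxCoord_mem (hsub hx), ?_⟩
        rwa [mem_preimage, apply_boxCoord (hsub hx)]
      · rintro ⟨hw, hw'⟩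
        exact ⟨_, hw', hσ.boxCoord_apply hw⟩
    rw [this]
    exact (hσ.continuousOn.mono openSquare_subset_closedSquare).isOpen_inter_preimage
      isOpen_openSquare hopen
  set J : Set ℝ := Prod.snd '' (boxCoord σ '' (ρ '' openSquare)) with hJ
  have hJconn : IsPreconnected J :=
    ((hρ.isPreconnected_image le_rfl le_rfl le_rfl le_rfl).image _ hcont).image _
      continuous_snd.continuousOn
  have hJsub : J ⊆ Ioo 0 1 := by
    rintro _ ⟨_, ⟨x, hx, rfl⟩, rfl⟩
    exact (boxCoord_mem (hsub hx)).2
  have hJne : J.Nonempty := by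
    have : openSquare.Nonempty := ⟨(1 / 2, 1 / 2), by norm_num [openSquare]⟩
    exact ((this.image _).image _).image _
  obtain ⟨a, b, ha, hab, hb, hJ'⟩ := exists_Ioo_of_isOpen_of_isPreconnected
    (isOpenMap_snd _ hU) hJconn hJne hJsub
  refine ⟨a, b, ha, hab, hb, subset_antisymm ?_ ?_⟩
  · intro x hx
    refine ⟨boxCoord σ x, ⟨(boxCoord_mem (hsub hx)).1, ?_⟩, apply_boxCoord (hsub hx)⟩
    rw [← hJ']
    exact ⟨_, ⟨x, hx, rfl⟩, rfl⟩
  · rintro _ ⟨⟨x, t⟩, ⟨hx, ht⟩, rfl⟩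
    dsimp only at hx ht
    rw [← hJ'] at ht
    obtain ⟨_, ⟨_, ⟨z, hz, rfl⟩, rfl⟩, rfl⟩ := ht
    have hzσ := hsub ⟨z, hz, rfl⟩
    exact mem_image_of_hSegment_eq hρ hσ hsub hz (boxCoord_mem hzσ)
      (hseg z hz _ (boxCoord_mem hzσ) (apply_boxCoord hzσ).symm) hx

/-- A box in `σ` whose vertical segments are vertical segments of `σ` is a vertical strip. -/
theorem exists_vertical_strip [T2Space S] (hρ : IsBox ρ) (hσ : IsBox σ)
    (hsub : ρ '' openSquare ⊆ σ '' openSquare)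
    (hseg : ∀ z ∈ openSquare, ∀ w ∈ openSquare, ρ z = σ w →
      (fun t => ρ (z.1, t)) '' Icc 0 1 = (fun t => σ (w.1, t)) '' Icc 0 1) :
    ∃ a b, 0 ≤ a ∧ a < b ∧ b ≤ 1 ∧ ρ '' openSquare = σ '' (Ioo a b ×ˢ Ioo 0 1) := by
  have hsq : ∀ τ : ℝ × ℝ → S, (τ ∘ Prod.swap) '' openSquare = τ '' openSquare :=
    fun τ => image_comp_swap τ _ _
  obtain ⟨a, b, ha, hab, hb, h⟩ := hρ.swap.exists_horizontal_strip hσ.swap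
    (by rwa [hsq, hsq]) fun z hz w hw h => hseg z.swap (swap_mem_openSquare.2 hz) w.swap
      (swap_mem_openSquare.2 hw) h
  exact ⟨a, b, ha, hab, hb, by rw [← hsq, h, image_comp_swap]⟩

end IsBox

/-! ### Winding numbers and restriction of rectangles -/

/-- Two loops around `p` and `p'` have the same winding number if their directions, seen from `p`
and `p'`, always differ by less than a right angle: the difference of directions is a loop in the
right half plane, where the argument is single-valued. -/
theorem HasWindingNumber.of_re_pos {γ γ' : ℝ → ℂ} {p p' : ℂ} {m : ℤ}
    (hγ : ContinuousOn γ (Icc 0 1)) (hγ' : ContinuousOn γ' (Icc 0 1)) (h0 : γ 0 = γ 1)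
    (h0' : γ' 0 = γ' 1)
    (hre : ∀ t ∈ Icc (0 : ℝ) 1, 0 < ((γ' t - p') * (starRingEnd ℂ) (γ t - p)).re)
    (h : HasWindingNumber γ p m) : HasWindingNumber γ' p' m := by
  obtain ⟨θ, hθ, hpolar, hm⟩ := h
  refine ⟨fun t => θ t + Complex.arg ((γ' t - p') * (starRingEnd ℂ) (γ t - p)), ?_, ?_, ?_⟩
  · refine hθ.add fun t ht => ?_
    refine ContinuousAt.comp_continuousWithinAt (g := Complex.arg)
      (f := fun t => (γ' t - p') * (starRingEnd ℂ) (γ t - p))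
      (Complex.continuousAt_arg (Complex.mem_slitPlane_iff.2 (Or.inl (hre t ht)))) ?_
    exact ((hγ' t ht).sub_const _).mul
      (Complex.continuous_conj.continuousAt.comp_continuousWithinAt ((hγ t ht).sub_const _))
  · intro t ht
    have hpos := hre t ht
    have hpt := hpolar t ht
    set x := γ t - p
    set y := γ' t - p'
    have hx : x ≠ 0 := by rintro hx; simp [hx] at hpos
    have harg := Complex.norm_mul_exp_arg_mul_I (y * (starRingEnd ℂ) x)
    rw [norm_mul, Complex.norm_conj] at harg
    have hnx : (‖x‖ : ℂ) ≠ 0 := by simpa using hx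
    have hxx : (starRingEnd ℂ) x * x = (‖x‖ : ℂ) ^ 2 := by
      rw [mul_comm, Complex.mul_conj, Complex.normSq_eq_norm_sq]; push_cast; rfl
    apply mul_right_cancel₀ (pow_ne_zero 2 hnx)
    calc y * (‖x‖ : ℂ) ^ 2 = (y * (starRingEnd ℂ) x) * x := by rw [← hxx]; ring
      _ = (((‖y‖ * ‖x‖ : ℝ) : ℂ) * Complex.exp (Complex.arg (y * (starRingEnd ℂ) x) * Complex.I)) *
          ((‖x‖ : ℂ) * Complex.exp (θ t * Complex.I)) := by rw [harg, ← hpt]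
      _ = _ := by
        push_cast
        rw [add_mul, Complex.exp_add]
        ring
  · dsimp only
    rw [← hm, h0, h0']
    ring

/-- Scaling the coordinates of the plane by positive factors preserves the orientation. -/
theorem PlaneOrientationPreservingAt.comp_affine {h : ℂ → ℂ} {p q a b : ℝ} (hp : 0 < p)
    (hq : 0 < q) {z : ℂ} (hh : PlaneOrientationPreservingAt h ⟨p * z.re + a, q * z.im + b⟩) :
    PlaneOrientationPreservingAt (fun w => h ⟨p * w.re + a, q * w.im + b⟩) z := by
  obtain ⟨W, hW, hwind⟩ := hh
  set A : ℂ → ℂ := fun w => ⟨p * w.re + a, q * w.im + b⟩ with hA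
  have hAc : Continuous A := by
    have : A = fun w : ℂ => ((p * w.re + a : ℝ) : ℂ) + ((q * w.im + b : ℝ) : ℂ) * Complex.I := by
      funext w; apply Complex.ext <;> simp [hA]
    rw [this]
    fun_prop
  have hre : ∀ w, w ≠ z → 0 < ((A w - A z) * (starRingEnd ℂ) (w - z)).re := by
    intro w hw
    have h1 : ((A w - A z) * (starRingEnd ℂ) (w - z)).re =
        p * (w.re - z.re) ^ 2 + q * (w.im - z.im) ^ 2 := by
      simp [hA]; ring
    rw [h1]
    by_cases hr : w.re = z.re
    · have hi : w.im - z.im ≠ 0 := fun hi => hw (Complex.ext hr (sub_eq_zero.1 hi))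
      have : 0 < (w.im - z.im) ^ 2 := by positivity
      positivity
    · have : 0 < (w.re - z.re) ^ 2 := by
        have := sub_ne_zero.2 hr
        positivity
      positivity
  refine ⟨A ⁻¹' W, hAc.continuousAt.preimage_mem_nhds hW, fun γ hγ h0 hmem m => ?_⟩
  have hre' : ∀ t ∈ Icc (0 : ℝ) 1, 0 < ((A (γ t) - A z) * (starRingEnd ℂ) (γ t - z)).re :=
    fun t ht => hre _ (hmem t ht).2
  have hAγ : ContinuousOn (A ∘ γ) (Icc 0 1) := hAc.comp_continuousOn hγ
  have h0' : (A ∘ γ) 0 = (A ∘ γ) 1 := congrArg A h0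
  have key := hwind (A ∘ γ) hAγ h0' (fun t ht => ⟨(hmem t ht).1, fun heq => by
    have := hre' t ht
    rw [show A (γ t) = A z from heq] at this
    simp at this⟩) m
  refine Iff.trans ⟨fun hw => ?_, fun hw => ?_⟩ key
  · exact hw.of_re_pos hγ hAγ h0 h0' hre'
  · refine hw.of_re_pos hAγ hγ h0' h0 fun t ht => ?_
    have h1 := hre' t ht
    simp only [Complex.mul_re, Complex.conj_re, Complex.conj_im, Function.comp] at h1 ⊢
    linarith

theorem MeasuredFoliation.IsLeafPath.comp {S : Type u} [TopologicalSpace S]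
    {F : MeasuredFoliation S} {γ : ℝ → S} (hγ : F.IsLeafPath γ) {l : ℝ → ℝ} (hl : Continuous l)
    (hmaps : MapsTo l (Icc 0 1) (Icc 0 1)) : F.IsLeafPath (fun s => γ (l s)) := by
  intro s hs c hc hsc
  exact (hl.continuousWithinAt.tendsto_nhdsWithin hmaps).eventually (hγ (l s) (hmaps hs) c hc hsc)

theorem mapsTo_affine_Icc {a b : ℝ} (ha : 0 ≤ a) (hab : a ≤ b) (hb : b ≤ 1) :
    MapsTo (fun s => (b - a) * s + a) (Icc 0 1) (Icc 0 1) := by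
  rintro s ⟨h0, h1⟩
  constructor <;> nlinarith

theorem image_affine_unitInterval {a b : ℝ} (hab : a < b) :
    (fun s => (b - a) * s + a) '' Icc 0 1 = Icc a b := by
  rw [image_affine_Icc' (sub_pos.2 hab)]; simp

theorem image_affine_openUnitInterval {a b : ℝ} (hab : a < b) :
    (fun s => (b - a) * s + a) '' Ioo 0 1 = Ioo a b := by
  rw [Set.image_affine_Ioo (sub_pos.2 hab)]; simp

section

variable {S : Type u} [TopologicalSpace S] [ChartedSpace ℂ S] {f : PseudoAnosov S}

namespace GeometricRectangle

theorem isBox (R : GeometricRectangle f) : IsBox R.ρ :=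
  ⟨R.continuousOn, R.isOpenEmbedding, R.injOn_horizontal, R.injOn_vertical⟩

/-- The restriction of a rectangle to `[a, b] × [c, d]`, with the directions of the rectangle. -/
def restrict (R : GeometricRectangle f) {a b c d : ℝ} (ha : 0 ≤ a) (hab : a < b) (hb : b ≤ 1)
    (hc : 0 ≤ c) (hcd : c < d) (hd : d ≤ 1) : GeometricRectangle f where
  ρ z := R.ρ ((b - a) * z.1 + a, (d - c) * z.2 + c)
  continuousOn := R.continuousOn.comp (by fun_prop) fun _ hz =>
    ⟨mapsTo_affine_Icc ha hab.le hb hz.1, mapsTo_affine_Icc hc hcd.le hd hz.2⟩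
  isOpenEmbedding := by
    let e : ℝ × ℝ ≃ₜ ℝ × ℝ := (affineHomeomorph (b - a) a (sub_pos.2 hab).ne').prodCongr
      (affineHomeomorph (d - c) c (sub_pos.2 hcd).ne')
    have hmaps : ∀ z ∈ openSquare, e z ∈ openSquare := fun z hz =>
      Ioo_prod_Ioo_subset_openSquare ha hb hc hd
        ⟨image_affine_openUnitInterval hab ▸ ⟨z.1, hz.1, rfl⟩, image_affine_openUnitInterval hcd ▸ ⟨z.2, hz.2, rfl⟩⟩
    refine IsOpenEmbedding.of_continuous_injective_isOpenMap ?_ ?_ ?_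
    · exact continuousOn_iff_continuous_domRestrict.1
        ((R.isBox.continuousOn.mono openSquare_subset_closedSquare).comp
          e.continuous.continuousOn hmaps)
    · intro z w h
      exact Subtype.ext (e.injective (R.isBox.injOn (hmaps z z.2) (hmaps w w.2) h))
    · intro U hU
      have h1 : IsOpen (e '' (Subtype.val '' U)) :=
        e.isOpenMap _ (isOpen_openSquare.isOpenMap_subtype_val U hU)
      convert R.isBox.isOpen_image h1 ?_ using 1
      · rw [image_image, image_image]
        rfl
      · rintro _ ⟨_, ⟨z, -, rfl⟩, rfl⟩
        exact hmaps z z.2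
  orientationPreserving := by
    intro z hz
    have hz' : ((b - a) * z.re + a, (d - c) * z.im + c) ∈ openSquare :=
      Ioo_prod_Ioo_subset_openSquare ha hb hc hd
        ⟨image_affine_openUnitInterval hab ▸ ⟨z.re, hz.1, rfl⟩, image_affine_openUnitInterval hcd ▸ ⟨z.im, hz.2, rfl⟩⟩
    have := R.orientationPreserving ⟨(b - a) * z.re + a, (d - c) * z.im + c⟩ hz'
    exact PlaneOrientationPreservingAt.comp_affine (sub_pos.2 hab) (sub_pos.2 hcd) this
  injOn_horizontal := by
    intro t ht s hs s' hs' h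
    have := R.injOn_horizontal _ (mapsTo_affine_Icc hc hcd.le hd ht)
      (mapsTo_affine_Icc ha hab.le hb hs) (mapsTo_affine_Icc ha hab.le hb hs') h
    simpa [(sub_pos.2 hab).ne'] using this
  injOn_vertical := by
    intro s hs t ht t' ht' h
    have := R.injOn_vertical _ (mapsTo_affine_Icc ha hab.le hb hs)
      (mapsTo_affine_Icc hc hcd.le hd ht) (mapsTo_affine_Icc hc hcd.le hd ht') h
    simpa [(sub_pos.2 hcd).ne'] using this
  stable_horizontal := fun t ht =>
    (R.stable_horizontal _ (mapsTo_affine_Icc hc hcd.le hd ht)).comp (by fun_prop)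
      (mapsTo_affine_Icc ha hab.le hb)
  unstable_vertical := fun s hs =>
    (R.unstable_vertical _ (mapsTo_affine_Icc ha hab.le hb hs)).comp (by fun_prop)
      (mapsTo_affine_Icc hc hcd.le hd)

section restrict

variable (R : GeometricRectangle f) {a b c d : ℝ} (ha : 0 ≤ a) (hab : a < b) (hb : b ≤ 1)
    (hc : 0 ≤ c) (hcd : c < d) (hd : d ≤ 1)

theorem restrict_ρ (z : ℝ × ℝ) : (R.restrict ha hab hb hc hcd hd).ρ z =
    R.ρ ((b - a) * z.1 + a, (d - c) * z.2 + c) := rfl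

theorem interior_restrict : (R.restrict ha hab hb hc hcd hd).interior =
    R.ρ '' (Ioo a b ×ˢ Ioo c d) := by
  rw [← image_affine_openUnitInterval hab, ← image_affine_openUnitInterval hcd, ← prodMap_image_prod, image_image]
  rfl

theorem carrier_restrict : (R.restrict ha hab hb hc hcd hd).carrier =
    R.ρ '' (Icc a b ×ˢ Icc c d) := by
  rw [← image_affine_unitInterval hab, ← image_affine_unitInterval hcd, ← prodMap_image_prod,
    image_image]
  rfl

theorem hInterval_restrict (t : ℝ) : (R.restrict ha hab hb hc hcd hd).hInterval t =
    (fun s => R.ρ (s, (d - c) * t + c)) '' Icc a b := by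
  rw [← image_affine_unitInterval hab, image_image]
  rfl

theorem vInterval_restrict (s : ℝ) : (R.restrict ha hab hb hc hcd hd).vInterval s =
    (fun t => R.ρ ((b - a) * s + a, t)) '' Icc c d := by
  rw [← image_affine_unitInterval hcd, image_image]
  rfl

end restrict

end GeometricRectangle

end

/-! ### Stable leaves in a rectangle -/

section

theorem eq_of_eventually_eq {α β : Type*} [TopologicalSpace α] {P : Set α} (hP : IsPreconnected P)
    {g : α → β} (hg : ∀ s ∈ P, ∀ᶠ s' in 𝓝[P] s, g s' = g s) {s s' : α} (hs : s ∈ P)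
    (hs' : s' ∈ P) : g s = g s' := by
  have : PreconnectedSpace P := Subtype.preconnectedSpace hP
  have hloc : IsLocallyConstant (fun x : P => g x) := by
    rw [IsLocallyConstant.iff_eventually_eq]
    intro x
    rw [nhds_subtype_eq_comap_nhdsWithin]
    exact (hg x x.2).comap _
  exact hloc.apply_eq_of_preconnectedSpace ⟨s, hs⟩ ⟨s', hs'⟩

/-- A continuous real function on a connected set is constant if it is locally constant at all the
points whose value lies outside some finite set. -/
theorem eq_of_eventually_eq_off_finite {α : Type*} [TopologicalSpace α] {P : Set α}
    (hP : IsPreconnected P) {g : α → ℝ} (hgc : ContinuousOn g P) {E : Set ℝ} (hE : E.Finite)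
    (hg : ∀ s ∈ P, g s ∉ E → ∀ᶠ s' in 𝓝[P] s, g s' = g s) {s s' : α} (hs : s ∈ P)
    (hs' : s' ∈ P) : g s = g s' := by
  by_contra hne
  have hinf : (g '' P).Infinite := (hP.image g hgc).infinite_of_nontrivial
    ⟨g s, ⟨s, hs, rfl⟩, g s', ⟨s', hs', rfl⟩, hne⟩
  -- a level outside the finite set is attained on a relatively clopen set
  obtain ⟨_, ⟨x, hx, rfl⟩, hxE⟩ := (hinf.sdiff hE).nonempty
  have hconst : ∀ y ∈ P, (g y = g x) = True := by
    intro y hy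
    have := eq_of_eventually_eq hP (g := fun y => g y = g x) ?_ hy hx
    · simpa using this
    · intro y hy
      by_cases hyx : g y = g x
      · filter_upwards [hg y hy (hyx ▸ hxE)] with y' hy'
        simp [hy', hyx]
      · filter_upwards [(hgc y hy).eventually_ne hyx] with y' hy'
        simp [hy', hyx]
  have h1 : g s = g x := of_eq_true (hconst s hs)
  have h2 : g s' = g x := of_eq_true (hconst s' hs')
  exact hne (h1.trans h2.symm)

variable {S : Type u} [TopologicalSpace S] [ChartedSpace ℂ S] {f : PseudoAnosov S}

/-- Near a regular interior point of a rectangle, the transverse coordinate of the stable foliation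
separates heights. In a chart that is transverse to both foliations, the imaginary part depends on
the height only, the real part on the abscissa only, and the rectangle is injective. -/
theorem GeometricRectangle.exists_coord_separating (R : GeometricRectangle f) {w₀ : ℝ × ℝ}
    (hw₀ : w₀ ∈ openSquare) (hreg : R.ρ w₀ ∉ f.Fs.sing) :
    ∃ c ∈ f.Fs.coords, R.ρ w₀ ∈ c.1 ∧
      ∀ᶠ w in 𝓝 w₀, c.2 (R.ρ w) = c.2 (R.ρ w₀) → w.2 = w₀.2 := by
  obtain ⟨φ, hφ, hφs, hφu⟩ := f.transverse.regular _ hreg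
  obtain ⟨c, hc, hxc⟩ := f.Fs.cover _ hreg
  obtain ⟨d, hd, hxd⟩ := f.Fu.cover _ (f.transverse.sing_eq ▸ hreg)
  refine ⟨c, hc, hxc, ?_⟩
  obtain ⟨a, k, hak⟩ := hφs c hc _ ⟨hxc, hφ⟩
  obtain ⟨b, l, hbl⟩ := hφu d hd _ ⟨hxd, hφ⟩
  have hgood : ∀ᶠ w in 𝓝 w₀, w ∈ openSquare ∧ R.ρ w ∈ φ.source ∧ R.ρ w ∈ c.1 ∧ R.ρ w ∈ d.1 ∧
      c.2 (R.ρ w) = ((a : ℤ) : ℝ) * (φ (R.ρ w)).im + k ∧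
      d.2 (R.ρ w) = ((b : ℤ) : ℝ) * (φ (R.ρ w)).re + l :=
    (isOpen_openSquare.eventually_mem hw₀).and ((R.isBox.continuousAt hw₀).eventually
      ((φ.open_source.eventually_mem hφ).and (((f.Fs.isOpen_coord c hc).eventually_mem hxc).and
        (((f.Fu.isOpen_coord d hd).eventually_mem hxd).and (hak.and hbl)))))
  obtain ⟨ε, hε, hball⟩ := Metric.eventually_nhds_iff_ball.1 hgood
  have hgood' : ∀ s ∈ Metric.ball w₀.1 ε, ∀ t ∈ Metric.ball w₀.2 ε, _ := fun s hs t ht =>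
    hball (s, t) (ball_prod_same w₀.1 w₀.2 ε ▸ ⟨hs, ht⟩)
  have h1 : w₀.1 ∈ Metric.ball w₀.1 ε := Metric.mem_ball_self hε
  have h2 : w₀.2 ∈ Metric.ball w₀.2 ε := Metric.mem_ball_self hε
  have hpre : ∀ x : ℝ, IsPreconnected (Metric.ball x ε) := fun x =>
    (convex_ball x ε).isPreconnected
  have hunit : ∀ e : ℤˣ, ((e : ℤ) : ℝ) ≠ 0 := fun e => by exact_mod_cast e.ne_zero
  filter_upwards [Metric.ball_mem_nhds w₀ hε] with w hw hcw
  obtain ⟨hw1, hw2⟩ : w.1 ∈ Metric.ball w₀.1 ε ∧ w.2 ∈ Metric.ball w₀.2 ε := by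
    rwa [← mem_prod, ball_prod_same]
  have hstable : c.2 (R.ρ (w.1, w.2)) = c.2 (R.ρ (w₀.1, w.2)) := by
    refine eq_of_eventually_eq (g := fun s => c.2 (R.ρ (s, w.2))) (hpre w₀.1) ?_ hw1 h1
    intro s hs
    have hg := hgood' s hs _ hw2
    have := R.stable_horizontal w.2 (Ioo_subset_Icc_self hg.1.2) s (Ioo_subset_Icc_self hg.1.1) c hc
      hg.2.2.1
    rw [nhdsWithin_eq_nhds.2 (Icc_mem_nhds hg.1.1.1 hg.1.1.2)] at this
    exact nhdsWithin_le_nhds this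
  have hunstable : d.2 (R.ρ (w₀.1, w.2)) = d.2 (R.ρ (w₀.1, w₀.2)) := by
    refine eq_of_eventually_eq (g := fun t => d.2 (R.ρ (w₀.1, t))) (hpre w₀.2) ?_ hw2 h2
    intro t ht
    have hg := hgood' _ h1 t ht
    have := R.unstable_vertical w₀.1 (Ioo_subset_Icc_self hg.1.1) t (Ioo_subset_Icc_self hg.1.2) d
      hd hg.2.2.2.1
    rw [nhdsWithin_eq_nhds.2 (Icc_mem_nhds hg.1.2.1 hg.1.2.2)] at this
    exact nhdsWithin_le_nhds this
  obtain ⟨hm, hsrc, -, -, him, hre⟩ := hgood' _ h1 _ hw2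
  obtain ⟨hm₀, hsrc₀, -, -, him₀, hre₀⟩ := hgood' _ h1 _ h2
  have him' : (φ (R.ρ (w₀.1, w.2))).im = (φ (R.ρ (w₀.1, w₀.2))).im := by
    have := hstable.symm.trans hcw
    rw [him, show R.ρ w₀ = R.ρ (w₀.1, w₀.2) from rfl, him₀] at this
    exact mul_left_cancel₀ (hunit a) (add_right_cancel this)
  have hre' : (φ (R.ρ (w₀.1, w.2))).re = (φ (R.ρ (w₀.1, w₀.2))).re := by
    rw [hre, hre₀] at hunstable
    exact mul_left_cancel₀ (hunit b) (add_right_cancel hunstable)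
  have := R.isBox.injOn hm hm₀ (φ.injOn hsrc hsrc₀ (Complex.ext hre' him'))
  exact (Prod.mk.inj this).2

/-- A path that runs in a stable leaf and in the interior of a rectangle has constant height. The
finitely many singular points do not matter, by continuity of the height. -/
theorem GeometricRectangle.height_eq_of_isLeafPath (R : GeometricRectangle f) {γ : ℝ → S}
    (hγ : ContinuousOn γ (Icc 0 1)) (hleaf : f.Fs.IsLeafPath γ)
    (hmem : ∀ s ∈ Icc (0 : ℝ) 1, γ s ∈ R.interior) {s s' : ℝ} (hs : s ∈ Icc (0 : ℝ) 1)
    (hs' : s' ∈ Icc (0 : ℝ) 1) : (boxCoord R.ρ (γ s)).2 = (boxCoord R.ρ (γ s')).2 := by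
  have hcont : ContinuousOn (fun s => boxCoord R.ρ (γ s)) (Icc 0 1) :=
    R.isBox.continuousOn_boxCoord.comp hγ hmem
  refine eq_of_eventually_eq_off_finite (g := fun s => (boxCoord R.ρ (γ s)).2) isPreconnected_Icc
    (continuous_snd.comp_continuousOn hcont)
    (f.Fs.sing_finite.image fun x => (boxCoord R.ρ x).2) ?_ hs hs'
  intro x hx hxE
  have hx' : R.ρ (boxCoord R.ρ (γ x)) = γ x := apply_boxCoord (hmem x hx)
  have hreg : γ x ∉ f.Fs.sing := fun h => hxE ⟨_, h, rfl⟩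
  obtain ⟨c, hc, hxc, hsep⟩ := R.exists_coord_separating (boxCoord_mem (hmem x hx))
    (by rwa [hx'])
  rw [hx'] at hxc hsep
  filter_upwards [hleaf x hx c hc hxc, (hcont x hx).eventually hsep, self_mem_nhdsWithin]
    with y hy hsepy hyI
  rw [apply_boxCoord (hmem y hyI)] at hsepy
  exact hsepy hy

/-- A pseudo-Anosov homeomorphism maps paths in stable leaves to paths in stable leaves. -/
theorem PseudoAnosov.isLeafPath_map (f : PseudoAnosov S) {γ : ℝ → S}
    (hγ : ContinuousOn γ (Icc 0 1)) (hleaf : f.Fs.IsLeafPath γ) :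
    f.Fs.IsLeafPath fun s => f.map (γ s) := by
  intro s hs d hd hsd
  have hreg : γ s ∉ f.Fs.sing := fun h =>
    (f.Fs.disjoint_sing d hd).notMem_of_mem_left hsd
      (f.pushforward_stable.1 ▸ mem_image_of_mem f.map h)
  obtain ⟨c, hc, hsc⟩ := f.Fs.cover _ hreg
  obtain ⟨a, k, hak⟩ := f.pushforward_stable.2 c hc d hd _ hsd (by simpa using hsc)
  have hne : ((a : ℤ) : ℝ) * f.stretch⁻¹ ≠ 0 := by
    refine mul_ne_zero (by exact_mod_cast a.ne_zero) (inv_ne_zero ?_)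
    linarith [f.one_lt_stretch]
  have h₀ := hak.self_of_nhds
  have hcont : ContinuousWithinAt (fun s => f.map (γ s)) (Icc 0 1) s :=
    f.map.continuous.continuousAt.comp_continuousWithinAt (hγ s hs)
  filter_upwards [hleaf s hs c hc hsc, hcont.eventually hak] with y hy hyk
  simp only [Homeomorph.symm_apply_apply] at hyk h₀
  rw [hy, h₀] at hyk
  have := add_right_cancel hyk
  rw [← mul_assoc, ← mul_assoc] at this
  exact (mul_left_cancel₀ hne this).symm

/-- The inverse of a pseudo-Anosov homeomorphism maps paths in stable leaves to paths in stable
leaves. -/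
theorem PseudoAnosov.isLeafPath_map_symm (f : PseudoAnosov S) {γ : ℝ → S}
    (hγ : ContinuousOn γ (Icc 0 1)) (hleaf : f.Fs.IsLeafPath γ) :
    f.Fs.IsLeafPath fun s => f.map.symm (γ s) := by
  intro s hs c hc hsc
  dsimp only at hsc
  have hreg : γ s ∉ f.Fs.sing := by
    intro h
    rw [← f.pushforward_stable.1] at h
    obtain ⟨x, hx, hxs⟩ := h
    rw [← hxs, Homeomorph.symm_apply_apply] at hsc
    exact (f.Fs.disjoint_sing c hc).notMem_of_mem_left hsc hx
  obtain ⟨d, hd, hsd⟩ := f.Fs.cover _ hreg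
  obtain ⟨a, k, hak⟩ := f.pushforward_stable.2 c hc d hd _ hsd hsc
  filter_upwards [hleaf s hs d hd hsd, (hγ s hs).eventually hak] with y hy hyk
  rw [hyk, hy]
  exact hak.self_of_nhds.symm

/-- If a homeomorphism that respects stable leaves maps a horizontal segment of `R` at height `t`
into the interior of `R'`, then the image has a constant height in `R'`. -/
theorem GeometricRectangle.height_map_eq (R R' : GeometricRectangle f) {g : S ≃ₜ S}
    (hg : ∀ γ : ℝ → S, ContinuousOn γ (Icc 0 1) → f.Fs.IsLeafPath γ →
      f.Fs.IsLeafPath fun s => g (γ s)) {t : ℝ} (ht : t ∈ Ioo (0 : ℝ) 1) {I : Set ℝ}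
    (hI : I.OrdConnected) (hI01 : I ⊆ Icc 0 1) (hmem : ∀ s ∈ I, g (R.ρ (s, t)) ∈ R'.interior)
    {s s' : ℝ} (hs : s ∈ I) (hs' : s' ∈ I) :
    (boxCoord R'.ρ (g (R.ρ (s, t)))).2 = (boxCoord R'.ρ (g (R.ρ (s', t)))).2 := by
  wlog hss : s ≤ s' generalizing s s'
  · exact (this hs' hs (le_of_not_ge hss)).symm
  have hmaps : MapsTo (fun x => (s' - s) * x + s) (Icc 0 1) I := by
    rintro x ⟨h0, h1⟩
    refine hI.out hs hs' ⟨?_, ?_⟩ <;> dsimp only <;> nlinarith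
  have hmaps' := hmaps.mono_right hI01
  have hcont : ContinuousOn (fun x => R.ρ ((s' - s) * x + s, t)) (Icc 0 1) :=
    R.continuousOn.comp (by fun_prop) fun x hx => ⟨hmaps' hx, Ioo_subset_Icc_self ht⟩
  have hleaf : f.Fs.IsLeafPath fun x => R.ρ ((s' - s) * x + s, t) :=
    (R.stable_horizontal t (Ioo_subset_Icc_self ht)).comp (by fun_prop) hmaps'
  have := R'.height_eq_of_isLeafPath (g.continuous.comp_continuousOn hcont)
    (hg _ hcont hleaf) (fun x hx => hmem _ (hmaps hx))
    (left_mem_Icc.2 zero_le_one) (right_mem_Icc.2 zero_le_one)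
  simpa using this

end

/-! ### Strips of a Markov partition -/

section

variable {S : Type u} [TopologicalSpace S]

theorem componentsOf_eq_singleton {A : Set S} (hA : IsPreconnected A) (hne : A.Nonempty) :
    componentsOf A = {A} := by
  ext C
  constructor
  · rintro ⟨x, hx, rfl⟩
    exact hA.connectedComponentIn hx
  · rintro rfl
    obtain ⟨x, hx⟩ := hne
    exact ⟨x, hx, (hA.connectedComponentIn hx).symm⟩

theorem componentsOf_empty : componentsOf (∅ : Set S) = ∅ := by
  ext C
  simp [componentsOf]

theorem nonempty_of_mem_componentsOf {A C : Set S} (hC : C ∈ componentsOf A) : C.Nonempty := by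
  obtain ⟨x, hx, rfl⟩ := hC
  exact ⟨x, mem_connectedComponentIn hx⟩

theorem subset_of_mem_componentsOf {A C : Set S} (hC : C ∈ componentsOf A) : C ⊆ A := by
  obtain ⟨x, hx, rfl⟩ := hC
  exact connectedComponentIn_subset A x

variable [ChartedSpace ℂ S] {f : PseudoAnosov S}

theorem GeometricRectangle.closure_interior [T2Space S] (R : GeometricRectangle f) :
    closure R.interior = R.carrier :=
  R.isBox.closure_image le_rfl zero_lt_one le_rfl le_rfl zero_lt_one le_rfl

theorem GeometricRectangle.isOpen_interior (R : GeometricRectangle f) : IsOpen R.interior :=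
  R.isBox.isOpen_image isOpen_openSquare subset_rfl

section Partition

variable {n : ℕ} {R : Fin n → GeometricRectangle f}

theorem IsGeometricMarkovPartition.exists_horizontal_strip [T2Space S]
    (hM : IsGeometricMarkovPartition f R) {i k : Fin n} {C : Set S}
    (hC : C ∈ componentsOf ((R i).interior ∩ f.map ⁻¹' (R k).interior)) :
    ∃ a b, 0 ≤ a ∧ a < b ∧ b ≤ 1 ∧ C = (R i).ρ '' (Ioo 0 1 ×ˢ Ioo a b) := by
  obtain ⟨H, rfl, -, -, hsub, hseg⟩ := hM.horizontal i k C hC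
  exact H.isBox.exists_horizontal_strip (R i).isBox hsub hseg

theorem IsGeometricMarkovPartition.exists_vertical_strip [T2Space S]
    (hM : IsGeometricMarkovPartition f R) {i k : Fin n} {C : Set S}
    (hC : C ∈ componentsOf (f.map '' (R i).interior ∩ (R k).interior)) :
    ∃ c d, 0 ≤ c ∧ c < d ∧ d ≤ 1 ∧ C = (R k).ρ '' (Ioo c d ×ˢ Ioo 0 1) := by
  obtain ⟨V, rfl, -, -, hsub, hseg⟩ := hM.vertical i k C hC
  exact V.isBox.exists_vertical_strip (R k).isBox hsub hseg

variable {h : Fin n → ℕ} {H : ∀ i, Fin (h i) → Set S}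

theorem IsHorizontalLabelling.exists_mem_componentsOf (hH : IsHorizontalLabelling f R h H)
    (i : Fin n) (j : Fin (h i)) :
    ∃ k, H i j ∈ componentsOf ((R i).interior ∩ f.map ⁻¹' (R k).interior) := by
  have : H i j ∈ range (H i) := ⟨j, rfl⟩
  rw [hH.1 i] at this
  exact mem_iUnion.1 this

theorem IsHorizontalLabelling.nonempty (hH : IsHorizontalLabelling f R h H) (i : Fin n)
    (j : Fin (h i)) : (H i j).Nonempty :=
  nonempty_of_mem_componentsOf (hH.exists_mem_componentsOf i j).choose_spec

theorem IsHorizontalLabelling.subset_interior (hH : IsHorizontalLabelling f R h H) (i : Fin n)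
    (j : Fin (h i)) : H i j ⊆ (R i).interior :=
  (subset_of_mem_componentsOf (hH.exists_mem_componentsOf i j).choose_spec).trans
    inter_subset_left

theorem IsHorizontalLabelling.exists_strip [T2Space S] (hH : IsHorizontalLabelling f R h H)
    (hM : IsGeometricMarkovPartition f R) (i : Fin n) (j : Fin (h i)) :
    ∃ a b, 0 ≤ a ∧ a < b ∧ b ≤ 1 ∧ H i j = (R i).ρ '' (Ioo 0 1 ×ˢ Ioo a b) :=
  hM.exists_horizontal_strip (hH.exists_mem_componentsOf i j).choose_spec

/-- Labels are determined by the sub-rectangles and their order from bottom to top. -/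
theorem IsHorizontalLabelling.eq {H' : ∀ i, Fin (h i) → Set S}
    (hH : IsHorizontalLabelling f R h H) (hH' : IsHorizontalLabelling f R h H') : H = H' := by
  funext i
  have hrange : range (H i) = range (H' i) := (hH.1 i).trans (hH'.1 i).symm
  have hmem : ∀ j, ∃ j', H' i j' = H i j := fun j => by
    have : H i j ∈ range (H' i) := hrange ▸ ⟨j, rfl⟩
    exact this
  choose σ hσ using hmem
  have hmono : StrictMono σ := by
    intro j j' hjj
    by_contra hle
    obtain ⟨_, hx⟩ := hH.nonempty i j
    obtain ⟨z, hz, rfl⟩ := hH.subset_interior i j hx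
    obtain ⟨_, hx'⟩ := hH.nonempty i j'
    obtain ⟨z', hz', rfl⟩ := hH.subset_interior i j' hx'
    have h1 := hH.2 i j j' hjj
    rcases (not_lt.1 hle).lt_or_eq with hlt | heq
    · have h2 := hH'.2 i _ _ hlt z' hz' z hz (by rwa [hσ]) (by rwa [hσ])
      exact lt_asymm h2 (h1 z hz z' hz' hx hx')
    · have : H i j = H i j' := by rw [← hσ, ← hσ, heq]
      exact lt_irrefl _ (h1 z hz z hz hx (this ▸ hx))
  have hid : σ = id := hmono.eq_id
  funext j
  rw [← hσ, hid]
  rfl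

theorem IsHorizontalLabelling.disjoint (hH : IsHorizontalLabelling f R h H)
    (hM : IsGeometricMarkovPartition f R) {x y : Σ i, Fin (h i)} (hxy : x ≠ y) :
    Disjoint (H x.1 x.2) (H y.1 y.2) := by
  obtain ⟨i, j⟩ := x
  obtain ⟨i', j'⟩ := y
  by_cases hi : i = i'
  · subst hi
    rw [Set.disjoint_left]
    intro x hx hx'
    obtain ⟨z, hz, rfl⟩ := hH.subset_interior i j hx
    have hj : j ≠ j' := fun hj => hxy (by rw [hj])
    rcases hj.lt_or_gt with hlt | hlt
    · exact lt_irrefl _ (hH.2 i _ _ hlt z hz z hz hx hx')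
    · exact lt_irrefl _ (hH.2 i _ _ hlt z hz z hz hx' hx)
  · exact (hM.disjoint i i' hi).mono (hH.subset_interior i j) (hH.subset_interior i' j')

/-- The closed horizontal sub-rectangles cover the surface: the union of the interiors of the
rectangles is open and dense, hence so is its intersection with its preimage. -/
theorem IsHorizontalLabelling.iUnion_closure [T2Space S] (hH : IsHorizontalLabelling f R h H)
    (hM : IsGeometricMarkovPartition f R) :
    ⋃ x : Σ i, Fin (h i), closure (H x.1 x.2) = univ := by
  have hopen : IsOpen (⋃ i, (R i).interior) := isOpen_iUnion fun i => (R i).isOpen_interior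
  have hdense : Dense (⋃ i, (R i).interior) := by
    rw [dense_iff_closure_eq, closure_iUnion_of_finite, ← hM.cover]
    simp only [GeometricRectangle.closure_interior]
  have hpre : Dense (f.map ⁻¹' ⋃ i, (R i).interior) := hdense.preimage f.map.isOpenMap
  have hinter := hdense.inter_of_isOpen_left hpre hopen
  rw [← closure_iUnion_of_finite, ← dense_iff_closure_eq]
  refine hinter.mono ?_
  rintro x ⟨hx, hx'⟩
  obtain ⟨i, hi⟩ := mem_iUnion.1 hx
  obtain ⟨k, hk⟩ := mem_iUnion.1 hx'
  have : connectedComponentIn ((R i).interior ∩ f.map ⁻¹' (R k).interior) x ∈ range (H i) := by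
    rw [hH.1 i]
    exact mem_iUnion.2 ⟨k, x, ⟨hi, hk⟩, rfl⟩
  obtain ⟨j, hj⟩ := this
  refine mem_iUnion.2 ⟨⟨i, j⟩, ?_⟩
  rw [hj]
  exact mem_connectedComponentIn ⟨hi, hk⟩

theorem IsVerticalLabelling.exists_strip [T2Space S] {v : Fin n → ℕ} {V : ∀ k, Fin (v k) → Set S}
    (hV : IsVerticalLabelling f R v V) (hM : IsGeometricMarkovPartition f R) (k : Fin n)
    (l : Fin (v k)) :
    ∃ c d, 0 ≤ c ∧ c < d ∧ d ≤ 1 ∧ V k l = (R k).ρ '' (Ioo c d ×ˢ Ioo 0 1) := by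
  have : V k l ∈ range (V k) := ⟨l, rfl⟩
  rw [hV.1 k] at this
  obtain ⟨i, hi⟩ := mem_iUnion.1 this
  exact hM.exists_vertical_strip hi

end Partition

/-! ### The map on a horizontal sub-rectangle -/

/-- `R` is a geometric Markov partition, and `H` and `V` label its horizontal and vertical
sub-rectangles in accordance with the geometric type `T`. -/
structure IsMarkovLabelling (f : PseudoAnosov S) (T : GeometricType)
    (R : Fin T.n → GeometricRectangle f) (H : ∀ i, Fin (T.h i) → Set S)
    (V : ∀ k, Fin (T.v k) → Set S) : Prop where
  markov : IsGeometricMarkovPartition f R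
  horizontal : IsHorizontalLabelling f R T.h H
  vertical : IsVerticalLabelling f R T.v V
  image_eq : ∀ x : T.HLabel, f.map '' H x.1 x.2 = V (T.ρ x).1 (T.ρ x).2
  ε_eq_one_iff : ∀ x : T.HLabel,
    T.ε x = 1 ↔ PreservesVerticalOn f (R x.1) (R (T.ρ x).1) (H x.1 x.2)

namespace IsMarkovLabelling

variable [T2Space S] {T : GeometricType} {R : Fin T.n → GeometricRectangle f}
  {H : ∀ i, Fin (T.h i) → Set S} {V : ∀ k, Fin (T.v k) → Set S}

/-- The whole horizontal sub-rectangle `x` is sent into a single rectangle. -/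
theorem map_mem_interior (M : IsMarkovLabelling f T R H V) (x : T.HLabel) {p : S}
    (hp : p ∈ H x.1 x.2) : f.map p ∈ (R (T.ρ x).1).interior := by
  obtain ⟨c, d, hc, -, hd, hV⟩ := M.vertical.exists_strip M.markov (T.ρ x).1 (T.ρ x).2
  have : f.map p ∈ V (T.ρ x).1 (T.ρ x).2 := M.image_eq x ▸ mem_image_of_mem _ hp
  rw [hV] at this
  exact image_mono (Ioo_prod_Ioo_subset_openSquare hc hd le_rfl le_rfl) this

/-- On the horizontal sub-rectangle `x`, the height of the image is a continuous strictly monotone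
function `β` of the height, with values filling `(0, 1)`; it is increasing if `ε x = 1` and
decreasing otherwise. -/
theorem exists_height (M : IsMarkovLabelling f T R H V) (x : T.HLabel) :
    ∃ (a b : ℝ) (β : ℝ → ℝ), 0 ≤ a ∧ a < b ∧ b ≤ 1 ∧
      H x.1 x.2 = (R x.1).ρ '' (Ioo 0 1 ×ˢ Ioo a b) ∧ ContinuousOn β (Ioo a b) ∧
      β '' Ioo a b = Ioo 0 1 ∧
      (∀ s ∈ Ioo (0 : ℝ) 1, ∀ t ∈ Ioo a b,
        (boxCoord (R (T.ρ x).1).ρ (f.map ((R x.1).ρ (s, t)))).2 = β t) ∧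
      (T.ε x = 1 ∧ StrictMonoOn β (Ioo a b) ∨ T.ε x ≠ 1 ∧ StrictAntiOn β (Ioo a b)) := by
  obtain ⟨a, b, ha, hab, hb, hH⟩ := M.horizontal.exists_strip M.markov x.1 x.2
  obtain ⟨c, d, hc, hcd, hd, hV⟩ := M.vertical.exists_strip M.markov (T.ρ x).1 (T.ρ x).2
  set ρ := (R x.1).ρ with hρ
  set σ := (R (T.ρ x).1).ρ with hσ
  have hbox : IsBox ρ := (R x.1).isBox
  have hbox' : IsBox σ := (R (T.ρ x).1).isBox
  have hhalf : (1 / 2 : ℝ) ∈ Ioo (0 : ℝ) 1 := by norm_num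
  have hab01 : Ioo a b ⊆ Ioo 0 1 := Ioo_subset_Ioo ha hb
  have hcd01 : Ioo c d ⊆ Ioo 0 1 := Ioo_subset_Ioo hc hd
  have hmemH : ∀ s ∈ Ioo (0 : ℝ) 1, ∀ t ∈ Ioo a b, ρ (s, t) ∈ H x.1 x.2 := fun s hs t ht =>
    hH ▸ ⟨(s, t), ⟨hs, ht⟩, rfl⟩
  have hmem : ∀ s ∈ Ioo (0 : ℝ) 1, ∀ t ∈ Ioo a b, f.map (ρ (s, t)) ∈ σ '' openSquare :=
    fun s hs t ht => M.map_mem_interior x (hmemH s hs t ht)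
  set β : ℝ → ℝ := fun t => (boxCoord σ (f.map (ρ (1 / 2, t)))).2 with hβ
  have hheight : ∀ s ∈ Ioo (0 : ℝ) 1, ∀ t ∈ Ioo a b,
      (boxCoord σ (f.map (ρ (s, t)))).2 = β t := fun s hs t ht =>
    (R x.1).height_map_eq (R (T.ρ x).1) (fun γ => f.isLeafPath_map) (hab01 ht) ordConnected_Ioo
      Ioo_subset_Icc_self (fun s hs => hmem s hs t ht) hs hhalf
  have hcont : ContinuousOn β (Ioo a b) := by
    refine continuous_snd.comp_continuousOn (hbox'.continuousOn_boxCoord.comp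
      (f.map.continuous.comp_continuousOn (hbox.continuousOn.comp (by fun_prop) ?_))
      fun t ht => hmem _ hhalf t ht)
    exact fun t ht => openSquare_subset_closedSquare ⟨hhalf, hab01 ht⟩
  have hpre : ∀ u ∈ Ioo c d, ∀ y ∈ Ioo (0 : ℝ) 1,
      ∃ s ∈ Ioo (0 : ℝ) 1, ∃ t ∈ Ioo a b, f.map (ρ (s, t)) = σ (u, y) := by
    intro u hu y hy
    have : σ (u, y) ∈ f.map '' H x.1 x.2 := by
      rw [M.image_eq, hV]
      exact ⟨(u, y), ⟨hu, hy⟩, rfl⟩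
    rw [hH] at this
    obtain ⟨_, ⟨⟨s, t⟩, ⟨hs, ht⟩, rfl⟩, h⟩ := this
    exact ⟨s, hs, t, ht, h⟩
  have himage : β '' Ioo a b = Ioo 0 1 := by
    apply subset_antisymm
    · rintro _ ⟨t, ht, rfl⟩
      exact (boxCoord_mem (hmem _ hhalf t ht)).2
    · intro y hy
      obtain ⟨u, hu⟩ := nonempty_Ioo.2 hcd
      obtain ⟨s, hs, t, ht, h⟩ := hpre u hu y hy
      refine ⟨t, ht, ?_⟩
      rw [← hheight s hs t ht, h, hbox'.boxCoord_apply ⟨hcd01 hu, hy⟩]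
  -- the inverse of `f` respects stable leaves too, so the height of a point is determined by
  -- the height of its image
  have hinj : InjOn β (Ioo a b) := by
    intro t ht t' ht' htt
    have himg : ∀ t ∈ Ioo a b, ∃ u ∈ Ioo c d, f.map (ρ (1 / 2, t)) = σ (u, β t) := by
      intro t ht
      have : f.map (ρ (1 / 2, t)) ∈ V (T.ρ x).1 (T.ρ x).2 :=
        M.image_eq x ▸ mem_image_of_mem _ (hmemH _ hhalf t ht)
      rw [hV] at this
      obtain ⟨⟨u, y⟩, ⟨hu, hy⟩, h⟩ := this
      refine ⟨u, hu, ?_⟩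
      simp only [hβ, ← h]
      rw [hbox'.boxCoord_apply ⟨hcd01 hu, hy⟩]
    obtain ⟨u, hu, hfu⟩ := himg t ht
    obtain ⟨u', hu', hfu'⟩ := himg t' ht'
    have hy : β t ∈ Ioo (0 : ℝ) 1 := himage ▸ ⟨t, ht, rfl⟩
    have key := (R (T.ρ x).1).height_map_eq (R x.1) (g := f.map.symm)
      (fun γ => f.isLeafPath_map_symm) hy (ordConnected_Ioo (a := c) (b := d))
      (hcd01.trans Ioo_subset_Icc_self) (fun w hw => by
        obtain ⟨s, hs, t₁, ht₁, h⟩ := hpre w hw _ hy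
        rw [← hσ, ← h, Homeomorph.symm_apply_apply]
        exact ⟨(s, t₁), ⟨hs, hab01 ht₁⟩, rfl⟩) hu hu'
    rw [← hσ, ← hρ, ← hfu, htt, ← hfu', Homeomorph.symm_apply_apply,
      Homeomorph.symm_apply_apply, hbox.boxCoord_apply ⟨hhalf, hab01 ht⟩,
      hbox.boxCoord_apply ⟨hhalf, hab01 ht'⟩] at key
    exact key
  refine ⟨a, b, β, ha, hab, hb, hH, hcont, himage, hheight, ?_⟩
  have hmemIoo : ∀ s t, (s, t) ∈ openSquare → ρ (s, t) ∈ H x.1 x.2 → t ∈ Ioo a b := by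
    intro s t hst hm
    rw [hH] at hm
    obtain ⟨w, hw, hwst⟩ := hm
    have := hbox.injOn (Ioo_prod_Ioo_subset_openSquare le_rfl le_rfl ha hb hw) hst hwst
    rw [this] at hw
    exact hw.2
  rcases hcont.strictMonoOn_of_injOn_Ioo hab hinj with hmono | hanti
  · refine Or.inl ⟨(M.ε_eq_one_iff x).2 ?_, hmono⟩
    intro s t t' hst hst' htt hm hm' w hw w' hw' h h'
    have ht := hmemIoo s t hst hm
    have ht' := hmemIoo s t' hst' hm'
    have h1 := hheight s hst.1 t ht
    have h2 := hheight s hst.1 t' ht'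
    rw [← hρ, ← hσ] at h h'
    rw [← h, hbox'.boxCoord_apply hw] at h1
    rw [← h', hbox'.boxCoord_apply hw'] at h2
    rw [h1, h2]
    exact hmono ht ht' htt
  · refine Or.inr ⟨fun hε => ?_, hanti⟩
    obtain ⟨t, hat, htb⟩ := exists_between hab
    obtain ⟨t', htt', ht'b⟩ := exists_between htb
    have ht : t ∈ Ioo a b := ⟨hat, htb⟩
    have ht' : t' ∈ Ioo a b := ⟨hat.trans htt', ht'b⟩
    have := (M.ε_eq_one_iff x).1 hε (1 / 2) t t' ⟨hhalf, hab01 ht⟩ ⟨hhalf, hab01 ht'⟩ htt'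
      (hmemH _ hhalf t ht) (hmemH _ hhalf t' ht') _ (boxCoord_mem (hmem _ hhalf t ht)) _
      (boxCoord_mem (hmem _ hhalf t' ht')) (apply_boxCoord (hmem _ hhalf t ht))
      (apply_boxCoord (hmem _ hhalf t' ht'))
    exact lt_asymm this (hanti ht ht' htt')

end IsMarkovLabelling

end

/-! ### Combinatorics of the binary refinement -/

namespace GeometricType

/-- The horizontal label of `T` that is the base rectangle `a` of the binary refinement. -/
def label (T : GeometricType) (a : Fin T.binaryRefinement.n) : T.HLabel := T.lex.symm a

theorem label_lex (T : GeometricType) (x : T.HLabel) : T.label (T.lex x) = x :=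
  T.lex.symm_apply_apply x

theorem lex_label (T : GeometricType) (a : Fin T.binaryRefinement.n) : T.lex (T.label a) = a :=
  T.lex.apply_symm_apply a

theorem label_injective (T : GeometricType) : Function.Injective T.label := T.lex.symm.injective

theorem flip_injective (e : ℤˣ) {m : ℕ} : Function.Injective (flip e (m := m)) :=
  Function.LeftInverse.injective (flip_flip e)

theorem label_binaryRefinement_ρ (T : GeometricType) (a : Fin T.binaryRefinement.n)
    (j : Fin (T.binaryRefinement.h a)) :
    T.label (T.binaryRefinement.ρ ⟨a, j⟩).1 =
      ⟨(T.ρ (T.label a)).1, flip (T.ε (T.label a)) (m := T.h (T.ρ (T.label a)).1) j⟩ :=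
  T.label_lex _

theorem ρ_label_binaryRefinement_symm (T : GeometricType) (b : Fin T.binaryRefinement.n)
    (l : Fin (T.v (T.label b).1)) :
    T.ρ (T.label (T.binaryRefinement.ρ.symm ⟨b, l⟩).1) = ⟨(T.label b).1, l⟩ := by
  have : T.label (T.binaryRefinement.ρ.symm ⟨b, l⟩).1 = T.ρ.symm ⟨(T.label b).1, l⟩ :=
    T.label_lex _
  rw [this, Equiv.apply_symm_apply]

/-- Distinct horizontal sub-rectangles of a rectangle of the refinement are sent into distinct
rectangles, which is why the incidence matrix is binary. -/
theorem binaryRefinement_ρ_fst_injective (T : GeometricType) (a : Fin T.binaryRefinement.n) :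
    Function.Injective fun j : Fin (T.binaryRefinement.h a) =>
      (T.binaryRefinement.ρ ⟨a, j⟩).1 := by
  intro j j' h
  have h' := congrArg T.label h
  dsimp only at h'
  rw [label_binaryRefinement_ρ, label_binaryRefinement_ρ] at h'
  exact flip_injective _ (eq_of_heq (Sigma.mk.inj h').2)

theorem exists_binaryRefinement_ρ_fst_eq_iff (T : GeometricType) (a b : Fin T.binaryRefinement.n) :
    (∃ j, (T.binaryRefinement.ρ ⟨a, j⟩).1 = b) ↔ (T.label b).1 = (T.ρ (T.label a)).1 := by
  constructor
  · rintro ⟨j, rfl⟩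
    rw [label_binaryRefinement_ρ]
  · intro h
    rcases hy : T.label b with ⟨k, m⟩
    rw [hy] at h
    dsimp only at h
    subst h
    refine ⟨flip (T.ε (T.label a)) m, T.label_injective ?_⟩
    exact (T.label_binaryRefinement_ρ _ _).trans
      ((congrArg (fun m => (⟨_, m⟩ : T.HLabel)) (flip_flip _ m)).trans hy.symm)

theorem incidence_binaryRefinement (T : GeometricType) (a b : Fin T.binaryRefinement.n) :
    T.binaryRefinement.incidence a b = if (T.label b).1 = (T.ρ (T.label a)).1 then 1 else 0 := by
  split_ifs with h
  · obtain ⟨j, rfl⟩ := (T.exists_binaryRefinement_ρ_fst_eq_iff a b).2 h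
    rw [incidence, Finset.card_eq_one]
    refine ⟨j, ?_⟩
    ext j'
    simp only [Finset.mem_filter, Finset.mem_univ, true_and, Finset.mem_singleton]
    exact ⟨fun h => T.binaryRefinement_ρ_fst_injective a h, fun h => by rw [h]⟩
  · rw [incidence, Finset.card_eq_zero, Finset.filter_eq_empty_iff]
    exact fun j _ hj => h ((T.exists_binaryRefinement_ρ_fst_eq_iff a b).1 ⟨j, hj⟩)

theorem isBinary_incidence_binaryRefinement (T : GeometricType) :
    IsBinary T.binaryRefinement.incidence := by
  intro a b
  rw [incidence_binaryRefinement]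
  split_ifs <;> simp

end GeometricType

/-! ### The horizontal refinement -/

section

variable {S : Type u} [TopologicalSpace S] [ChartedSpace ℂ S] {f : PseudoAnosov S}

theorem GeometricRectangle.SameDirections.fst_eq_iff {H R : GeometricRectangle f}
    (hd : H.SameDirections R) {z z' w w' : ℝ × ℝ} (hz : z ∈ openSquare) (hz' : z' ∈ openSquare)
    (hw : w ∈ openSquare) (hw' : w' ∈ openSquare) (h : H.ρ z = R.ρ w) (h' : H.ρ z' = R.ρ w') :
    z.1 = z'.1 ↔ w.1 = w'.1 := by
  have h1 := (hd z hz z' hz' w hw w' hw' h h').1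
  have h2 := (hd z' hz' z hz w' hw' w hw h' h).1
  constructor <;> intro heq <;> apply le_antisymm <;> apply not_lt.1
  · rw [← h2, heq]; exact lt_irrefl _
  · rw [← h1, heq]; exact lt_irrefl _
  · rw [h2, heq]; exact lt_irrefl _
  · rw [h1, heq]; exact lt_irrefl _

variable {T : GeometricType} {R : Fin T.n → GeometricRectangle f}
  {H : ∀ i, Fin (T.h i) → Set S} {V : ∀ k, Fin (T.v k) → Set S}

theorem HasGeometricType.exists_isMarkovLabelling (hT : HasGeometricType f T R)
    (hM : IsGeometricMarkovPartition f R) : ∃ H V, IsMarkovLabelling f T R H V := by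
  obtain ⟨H, V, hH, hV, himage, hε⟩ := hT
  exact ⟨H, V, hM, hH, hV, himage, hε⟩

/-- `B` is the family of the horizontal sub-rectangles `H`, with the directions of `R`. -/
structure IsRefinement (f : PseudoAnosov S) (T : GeometricType)
    (R : Fin T.n → GeometricRectangle f) (H : ∀ i, Fin (T.h i) → Set S)
    (B : Fin T.binaryRefinement.n → GeometricRectangle f) : Prop where
  interior_eq : ∀ a, (B a).interior = H (T.label a).1 (T.label a).2
  isHorizontalSub : ∀ a, (B a).IsHorizontalSub (R (T.label a).1)
  sameDirections : ∀ a, (B a).SameDirections (R (T.label a).1)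

theorem IsHorizontalRefinement.isRefinement {B : Fin T.binaryRefinement.n → GeometricRectangle f}
    (hB : IsHorizontalRefinement f T R B) (hH : IsHorizontalLabelling f R T.h H) :
    IsRefinement f T R H B := by
  obtain ⟨H', hH', h⟩ := hB
  obtain rfl := hH.eq hH'
  have h' : ∀ a, _ := fun a => h (T.label a)
  simp only [T.lex_label] at h'
  exact ⟨fun a => (h' a).1, fun a => (h' a).2.2.1, fun a => (h' a).2.2.2⟩

theorem IsRefinement.exists_eq {B : Fin T.binaryRefinement.n → GeometricRectangle f}
    (hB : IsRefinement f T R H B) (hH : IsHorizontalLabelling f R T.h H)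
    {a : Fin T.binaryRefinement.n} {z : ℝ × ℝ} (hz : z ∈ openSquare) :
    ∃ w ∈ openSquare, (R (T.label a).1).ρ w = (B a).ρ z := by
  have : (B a).ρ z ∈ (B a).interior := ⟨z, hz, rfl⟩
  rw [hB.interior_eq] at this
  exact hH.subset_interior _ _ this

variable [T2Space S]

/-- Vertical segments of a rectangle that fills a horizontal strip of `R` and has the vertical
direction of `R`. -/
theorem GeometricRectangle.vInterval_eq_of_sameDirections {B R : GeometricRectangle f} {a b : ℝ}
    (ha : 0 ≤ a) (hab : a < b) (hb : b ≤ 1) (hint : B.interior = R.ρ '' (Ioo 0 1 ×ˢ Ioo a b))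
    (hd : B.SameDirections R) {z w : ℝ × ℝ} (hz : z ∈ openSquare) (hw : w ∈ openSquare)
    (h : B.ρ z = R.ρ w) : B.vInterval z.1 = (fun t => R.ρ (w.1, t)) '' Icc a b := by
  have hclosure : ∀ (Q : GeometricRectangle f) (x : ℝ), x ∈ Ioo (0 : ℝ) 1 → ∀ p q : ℝ, 0 ≤ p →
      p < q → q ≤ 1 → closure ((fun t => Q.ρ (x, t)) '' Ioo p q) =
        (fun t => Q.ρ (x, t)) '' Icc p q := by
    intro Q x hx p q hp hpq hq
    have hcont : ContinuousOn (fun t => Q.ρ (x, t)) (Icc p q) :=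
      Q.continuousOn.comp (by fun_prop) fun t ht =>
        ⟨Ioo_subset_Icc_self hx, Icc_subset_Icc hp hq ht⟩
    apply subset_antisymm
    · exact closure_minimal (image_mono Ioo_subset_Icc_self)
        (isCompact_Icc.image_of_continuousOn hcont).isClosed
    · rw [← closure_Ioo hpq.ne] at hcont ⊢
      exact hcont.image_closure
  have hsub := Ioo_prod_Ioo_subset_openSquare (le_refl (0 : ℝ)) (le_refl (1 : ℝ)) ha hb
  rw [vInterval, ← hclosure B z.1 hz.1 0 1 le_rfl zero_lt_one le_rfl,
    ← hclosure R w.1 hw.1 a b ha hab hb]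
  congr 1
  apply subset_antisymm
  · rintro _ ⟨t, ht, rfl⟩
    have hzt : (z.1, t) ∈ openSquare := ⟨hz.1, ht⟩
    have : B.ρ (z.1, t) ∈ B.interior := ⟨_, hzt, rfl⟩
    rw [hint] at this
    obtain ⟨⟨s', t'⟩, hw', h'⟩ := this
    have := (hd.fst_eq_iff hz hzt hw (hsub hw') h h'.symm).1 rfl
    exact ⟨t', hw'.2, by rw [this]; exact h'⟩
  · rintro _ ⟨t, ht, rfl⟩
    have hwt : (w.1, t) ∈ Ioo (0 : ℝ) 1 ×ˢ Ioo a b := ⟨hw.1, ht⟩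
    have : R.ρ (w.1, t) ∈ B.interior := hint ▸ ⟨_, hwt, rfl⟩
    obtain ⟨⟨s', t'⟩, hz', h'⟩ := this
    have := (hd.fst_eq_iff hz hz' hw (hsub hwt) h h').2 rfl
    exact ⟨t', hz'.2, by rw [this]; exact h'⟩

theorem IsHorizontalLabelling.exists_isHorizontalRefinement
    (hH : IsHorizontalLabelling f R T.h H) (hM : IsGeometricMarkovPartition f R) :
    ∃ B, IsHorizontalRefinement f T R B := by
  have key : ∀ x : T.HLabel, ∃ Q : GeometricRectangle f, Q.interior = H x.1 x.2 ∧
      Q.carrier = closure (H x.1 x.2) ∧ Q.IsHorizontalSub (R x.1) ∧ Q.SameDirections (R x.1) := by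
    intro x
    obtain ⟨a, b, ha, hab, hb, hstrip⟩ := hH.exists_strip hM x.1 x.2
    have hint := (R x.1).interior_restrict le_rfl zero_lt_one le_rfl ha hab hb
    rw [← hstrip] at hint
    have hcoord : ∀ z ∈ openSquare, ∀ w ∈ openSquare,
        ((R x.1).restrict le_rfl zero_lt_one le_rfl ha hab hb).ρ z = (R x.1).ρ w →
        w = (z.1, (b - a) * z.2 + a) := by
      intro z hz w hw h
      rw [GeometricRectangle.restrict_ρ] at h
      have := (R x.1).isBox.eq_of_mem_openSquare ?_ hw h
      · rw [← this]; simp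
      · exact ⟨mapsTo_affine_Icc le_rfl zero_le_one le_rfl (Ioo_subset_Icc_self hz.1),
          mapsTo_affine_Icc ha hab.le hb (Ioo_subset_Icc_self hz.2)⟩
    refine ⟨(R x.1).restrict le_rfl zero_lt_one le_rfl ha hab hb, hint, ?_, ⟨?_, ?_, ?_⟩, ?_⟩
    · rw [← GeometricRectangle.closure_interior, hint]
    · rw [GeometricRectangle.carrier_restrict]
      exact image_mono (Icc_prod_Icc_subset_closedSquare le_rfl le_rfl ha hb)
    · rw [hint]
      exact hH.subset_interior x.1 x.2
    · intro z hz w hw h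
      rw [hcoord z hz w hw h, GeometricRectangle.hInterval_restrict]
      rfl
    · intro z hz z' hz' w hw w' hw' h h'
      rw [hcoord z hz w hw h, hcoord z' hz' w' hw' h']
      have := sub_pos.2 hab
      simp [this]
  choose Q hQ using key
  refine ⟨fun a => Q (T.label a), H, hH, fun x => ?_⟩
  have hx : (fun a => Q (T.label a)) (T.lex x) = Q x := congrArg Q (T.label_lex x)
  rw [hx]
  exact hQ x

namespace IsMarkovLabelling

theorem inter_preimage_eq_empty (M : IsMarkovLabelling f T R H V) {x y : T.HLabel}
    (hy : y.1 ≠ (T.ρ x).1) : H x.1 x.2 ∩ f.map ⁻¹' H y.1 y.2 = ∅ := by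
  rw [← Set.disjoint_iff_inter_eq_empty, Set.disjoint_left]
  intro p hp hp'
  exact (M.markov.disjoint _ _ hy).le_bot
    ⟨M.horizontal.subset_interior _ _ hp', M.map_mem_interior x hp⟩

/-- The part of the horizontal sub-rectangle `x` that is sent into the horizontal sub-rectangle `y`
is a horizontal strip. -/
theorem inter_preimage_eq (M : IsMarkovLabelling f T R H V) {x y : T.HLabel}
    (hy : y.1 = (T.ρ x).1) : ∃ p q, 0 ≤ p ∧ p < q ∧ q ≤ 1 ∧
      H x.1 x.2 ∩ f.map ⁻¹' H y.1 y.2 = (R x.1).ρ '' (Ioo 0 1 ×ˢ Ioo p q) := by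
  obtain ⟨k, m⟩ := y
  obtain rfl : k = (T.ρ x).1 := hy
  obtain ⟨a, b, β, ha, hab, hb, hH, hcont, himage, hheight, hβ⟩ := M.exists_height x
  obtain ⟨a', b', ha', hab', hb', hH'⟩ := M.horizontal.exists_strip M.markov (T.ρ x).1 m
  have hbox := (R (T.ρ x).1).isBox
  have hJopen : IsOpen (Ioo a b ∩ β ⁻¹' Ioo a' b') := hcont.isOpen_inter_preimage isOpen_Ioo
    isOpen_Ioo
  have hJconn : IsPreconnected (Ioo a b ∩ β ⁻¹' Ioo a' b') := by
    refine (ordConnected_def.2 fun t ht t' ht' u hu => ?_).isPreconnected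
    have huab : u ∈ Ioo a b := ordConnected_Ioo.out ht.1 ht'.1 hu
    refine ⟨huab, ?_⟩
    rcases hβ with ⟨-, hm⟩ | ⟨-, hm⟩
    · exact ordConnected_Ioo.out ht.2 ht'.2
        ⟨hm.monotoneOn ht.1 huab hu.1, hm.monotoneOn huab ht'.1 hu.2⟩
    · exact ordConnected_Ioo.out ht'.2 ht.2
        ⟨hm.antitoneOn huab ht'.1 hu.2, hm.antitoneOn ht.1 huab hu.1⟩
  have hJne : (Ioo a b ∩ β ⁻¹' Ioo a' b').Nonempty := by
    obtain ⟨y, hy⟩ := nonempty_Ioo.2 hab'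
    have : y ∈ β '' Ioo a b := himage ▸ Ioo_subset_Ioo ha' hb' hy
    obtain ⟨t, ht, rfl⟩ := this
    exact ⟨t, ht, hy⟩
  obtain ⟨p, q, hp, hpq, hq, hJ⟩ := exists_Ioo_of_isOpen_of_isPreconnected hJopen hJconn hJne
    inter_subset_left
  refine ⟨p, q, ha.trans hp, hpq, hq.trans hb, ?_⟩
  rw [← hJ]
  have hmem : ∀ s ∈ Ioo (0 : ℝ) 1, ∀ t ∈ Ioo a b,
      (f.map ((R x.1).ρ (s, t)) ∈ H (T.ρ x).1 m ↔ β t ∈ Ioo a' b') := by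
    intro s hs t ht
    have hint : f.map ((R x.1).ρ (s, t)) ∈ (R (T.ρ x).1).interior :=
      M.map_mem_interior x (by rw [hH]; exact ⟨(s, t), ⟨hs, ht⟩, rfl⟩)
    rw [← hheight s hs t ht, hH']
    constructor
    · rintro ⟨w, hw, hwf⟩
      rw [← hwf, hbox.boxCoord_apply
        (Ioo_prod_Ioo_subset_openSquare le_rfl le_rfl ha' hb' hw)]
      exact hw.2
    · intro hc
      exact ⟨_, ⟨(boxCoord_mem hint).1, hc⟩, apply_boxCoord hint⟩
  apply subset_antisymm
  · rintro _ ⟨hp, hp'⟩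
    rw [hH] at hp
    obtain ⟨⟨s, t⟩, ⟨hs, ht⟩, rfl⟩ := hp
    exact ⟨(s, t), ⟨hs, ht, (hmem s hs t ht).1 hp'⟩, rfl⟩
  · rintro _ ⟨⟨s, t⟩, ⟨hs, ht, ht'⟩, rfl⟩
    refine ⟨?_, (hmem s hs t ht).2 ht'⟩
    rw [hH]
    exact ⟨(s, t), ⟨hs, ht⟩, rfl⟩

/-- The part of the horizontal sub-rectangle `y` that is covered by the image of the horizontal
sub-rectangle `x` fills `y` vertically. -/
theorem image_inter_eq (M : IsMarkovLabelling f T R H V) {x y : T.HLabel}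
    (hy : y.1 = (T.ρ x).1) : ∃ c d a b, 0 ≤ c ∧ c < d ∧ d ≤ 1 ∧ 0 ≤ a ∧ a < b ∧ b ≤ 1 ∧
      f.map '' H x.1 x.2 ∩ H y.1 y.2 = (R y.1).ρ '' (Ioo c d ×ˢ Ioo a b) ∧
      H y.1 y.2 = (R y.1).ρ '' (Ioo 0 1 ×ˢ Ioo a b) := by
  obtain ⟨k, m⟩ := y
  obtain rfl : k = (T.ρ x).1 := hy
  obtain ⟨c, d, hc, hcd, hd, hV⟩ := M.vertical.exists_strip M.markov (T.ρ x).1 (T.ρ x).2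
  obtain ⟨a, b, ha, hab, hb, hH⟩ := M.horizontal.exists_strip M.markov (T.ρ x).1 m
  refine ⟨c, d, a, b, hc, hcd, hd, ha, hab, hb, ?_, hH⟩
  dsimp only
  rw [M.image_eq, hV, hH, ← (R (T.ρ x).1).isBox.injOn.image_inter
    (Ioo_prod_Ioo_subset_openSquare hc hd le_rfl le_rfl)
    (Ioo_prod_Ioo_subset_openSquare le_rfl le_rfl ha hb), prod_inter_prod,
    inter_eq_left.2 (Ioo_subset_Ioo hc hd), inter_eq_right.2 (Ioo_subset_Ioo ha hb)]

/-- On the horizontal sub-rectangle `x`, the map preserves the order of heights if `ε x = 1` and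
reverses it otherwise. -/
theorem height_lt_iff (M : IsMarkovLabelling f T R H V) (x : T.HLabel) {z z' w w' : ℝ × ℝ}
    (hz : z ∈ openSquare) (hz' : z' ∈ openSquare) (hw : w ∈ openSquare) (hw' : w' ∈ openSquare)
    (hzH : (R x.1).ρ z ∈ H x.1 x.2) (hzH' : (R x.1).ρ z' ∈ H x.1 x.2)
    (h : (R (T.ρ x).1).ρ w = f.map ((R x.1).ρ z))
    (h' : (R (T.ρ x).1).ρ w' = f.map ((R x.1).ρ z')) :
    (T.ε x = 1 → (w.2 < w'.2 ↔ z.2 < z'.2)) ∧ (T.ε x ≠ 1 → (w.2 < w'.2 ↔ z'.2 < z.2)) := by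
  obtain ⟨a, b, β, ha, hab, hb, hH, -, -, hheight, hβ⟩ := M.exists_height x
  have key : ∀ z ∈ openSquare, ∀ w ∈ openSquare, (R x.1).ρ z ∈ H x.1 x.2 →
      (R (T.ρ x).1).ρ w = f.map ((R x.1).ρ z) → z.2 ∈ Ioo a b ∧ w.2 = β z.2 := by
    intro z hz w hw hm h
    rw [hH] at hm
    obtain ⟨u, hu, huz⟩ := hm
    obtain rfl := (R x.1).isBox.injOn
      (Ioo_prod_Ioo_subset_openSquare le_rfl le_rfl ha hb hu) hz huz
    refine ⟨hu.2, ?_⟩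
    rw [← hheight u.1 hu.1 u.2 hu.2, ← h, (R (T.ρ x).1).isBox.boxCoord_apply hw]
  obtain ⟨hzI, hwz⟩ := key z hz w hw hzH h
  obtain ⟨hzI', hwz'⟩ := key z' hz' w' hw' hzH' h'
  rw [hwz, hwz']
  rcases hβ with ⟨hε, hm⟩ | ⟨hε, hm⟩
  · exact ⟨fun _ => hm.lt_iff_lt hzI hzI', fun h => absurd hε h⟩
  · exact ⟨fun h => absurd h hε, fun _ => hm.lt_iff_gt hzI hzI'⟩

end IsMarkovLabelling

namespace IsRefinement

variable {B : Fin T.binaryRefinement.n → GeometricRectangle f}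

theorem componentsOf_inter_preimage (hB : IsRefinement f T R H B)
    (M : IsMarkovLabelling f T R H V) (a b : Fin T.binaryRefinement.n) :
    componentsOf ((B a).interior ∩ f.map ⁻¹' (B b).interior) =
      if (T.label b).1 = (T.ρ (T.label a)).1 then
        {(B a).interior ∩ f.map ⁻¹' (B b).interior} else ∅ := by
  rw [hB.interior_eq, hB.interior_eq]
  split_ifs with h
  · obtain ⟨p, q, hp, hpq, hq, heq⟩ := M.inter_preimage_eq h
    rw [heq]
    exact componentsOf_eq_singleton ((R _).isBox.isPreconnected_image le_rfl le_rfl hp hq)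
      (((nonempty_Ioo.2 zero_lt_one).prod (nonempty_Ioo.2 hpq)).image _)
  · rw [M.inter_preimage_eq_empty h, componentsOf_empty]

theorem componentsOf_image_inter (hB : IsRefinement f T R H B)
    (M : IsMarkovLabelling f T R H V) (a b : Fin T.binaryRefinement.n) :
    componentsOf (f.map '' (B a).interior ∩ (B b).interior) =
      if (T.label b).1 = (T.ρ (T.label a)).1 then
        {f.map '' (B a).interior ∩ (B b).interior} else ∅ := by
  rw [hB.interior_eq, hB.interior_eq]
  split_ifs with h
  · obtain ⟨c, d, p, q, hc, hcd, hd, hp, hpq, hq, heq, -⟩ := M.image_inter_eq h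
    rw [heq]
    exact componentsOf_eq_singleton ((R _).isBox.isPreconnected_image hc hd hp hq)
      (((nonempty_Ioo.2 hcd).prod (nonempty_Ioo.2 hpq)).image _)
  · rw [← image_inter_preimage, M.inter_preimage_eq_empty h, image_empty, componentsOf_empty]

theorem isGeometricMarkovPartition (hB : IsRefinement f T R H B)
    (M : IsMarkovLabelling f T R H V) : IsGeometricMarkovPartition f B where
  cover := by
    rw [← M.horizontal.iUnion_closure M.markov]
    refine (iUnion_congr fun a => ?_).trans
      (T.lex.symm.surjective.iUnion_comp fun x => closure (H x.1 x.2))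
    rw [← GeometricRectangle.closure_interior, hB.interior_eq]
    rfl
  disjoint := by
    intro a b hab
    rw [hB.interior_eq, hB.interior_eq]
    exact M.horizontal.disjoint M.markov (T.label_injective.ne hab)
  horizontal := by
    intro a b C hC
    rw [hB.componentsOf_inter_preimage M] at hC
    split_ifs at hC with h
    · obtain rfl := hC
      obtain ⟨p, q, hp, hpq, hq, heq⟩ := M.inter_preimage_eq h
      rw [← hB.interior_eq, ← hB.interior_eq] at heq
      have hint := (R (T.label a).1).interior_restrict le_rfl zero_lt_one le_rfl hp hpq hq
      rw [← heq] at hint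
      refine ⟨(R (T.label a).1).restrict le_rfl zero_lt_one le_rfl hp hpq hq, hint, ?_, ?_, ?_, ?_⟩
      · rw [← GeometricRectangle.closure_interior, hint]
      · rw [← GeometricRectangle.closure_interior, ← GeometricRectangle.closure_interior, hint]
        exact closure_mono inter_subset_left
      · rw [hint]
        exact inter_subset_left
      · intro z hz w hw hzw
        rw [GeometricRectangle.hInterval_restrict]
        rw [GeometricRectangle.restrict_ρ] at hzw
        have hz2 : (q - p) * z.2 + p ∈ Ioo p q :=
          image_affine_openUnitInterval hpq ▸ mem_image_of_mem _ hz.2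
        have hz1 : ((1 : ℝ) - 0) * z.1 + 0 ∈ Ioo (0 : ℝ) 1 :=
          image_affine_openUnitInterval (zero_lt_one' ℝ) ▸ mem_image_of_mem _ hz.1
        exact ((hB.isHorizontalSub a).2.2 w hw _
          ⟨hz1, Ioo_subset_Ioo hp hq hz2⟩ hzw.symm).symm
    · exact hC.elim
  vertical := by
    intro a b C hC
    rw [hB.componentsOf_image_inter M] at hC
    split_ifs at hC with h
    · obtain rfl := hC
      obtain ⟨c, d, p, q, hc, hcd, hd, hp, hpq, hq, heq, hstrip⟩ := M.image_inter_eq h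
      rw [← hB.interior_eq, ← hB.interior_eq] at heq
      rw [← hB.interior_eq] at hstrip
      have hint := (R (T.label b).1).interior_restrict hc hcd hd hp hpq hq
      rw [← heq] at hint
      refine ⟨(R (T.label b).1).restrict hc hcd hd hp hpq hq, hint, ?_, ?_, ?_, ?_⟩
      · rw [← GeometricRectangle.closure_interior, hint]
      · rw [← GeometricRectangle.closure_interior, ← GeometricRectangle.closure_interior, hint]
        exact closure_mono inter_subset_right
      · rw [hint]
        exact inter_subset_right
      · intro z hz w hw hzw
        rw [GeometricRectangle.vInterval_restrict]
        rw [GeometricRectangle.restrict_ρ] at hzw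
        have hz1 : (d - c) * z.1 + c ∈ Ioo c d :=
          image_affine_openUnitInterval hcd ▸ mem_image_of_mem _ hz.1
        have hz2 : (q - p) * z.2 + p ∈ Ioo p q :=
          image_affine_openUnitInterval hpq ▸ mem_image_of_mem _ hz.2
        exact (GeometricRectangle.vInterval_eq_of_sameDirections hp hpq hq hstrip
          (hB.sameDirections b) hw ⟨Ioo_subset_Ioo hc hd hz1, Ioo_subset_Ioo hp hq hz2⟩
          hzw.symm).symm
    · exact hC.elim

theorem partitionIncidence_eq (hB : IsRefinement f T R H B) (M : IsMarkovLabelling f T R H V) :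
    partitionIncidence f B = T.binaryRefinement.incidence := by
  funext a b
  rw [T.incidence_binaryRefinement, partitionIncidence, hB.componentsOf_inter_preimage M]
  split_ifs <;> simp

/-- The `j`-th horizontal sub-rectangle of `B a` is the part sent into the rectangle `ρ'(a, j)`. -/
theorem isHorizontalLabelling (hB : IsRefinement f T R H B) (M : IsMarkovLabelling f T R H V) :
    IsHorizontalLabelling f B T.binaryRefinement.h fun a j =>
      (B a).interior ∩ f.map ⁻¹' (B (T.binaryRefinement.ρ ⟨a, j⟩).1).interior := by
  constructor
  · intro a
    ext C
    simp only [mem_range, mem_iUnion, hB.componentsOf_inter_preimage M]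
    constructor
    · rintro ⟨j, rfl⟩
      refine ⟨(T.binaryRefinement.ρ ⟨a, j⟩).1, ?_⟩
      rw [if_pos ((T.exists_binaryRefinement_ρ_fst_eq_iff a _).1 ⟨j, rfl⟩)]
      rfl
    · rintro ⟨b, hb⟩
      split_ifs at hb with h
      · obtain ⟨j, rfl⟩ := (T.exists_binaryRefinement_ρ_fst_eq_iff a b).2 h
        exact ⟨j, hb.symm⟩
      · exact hb.elim
  · rintro a j j' hjj z hz z' hz' ⟨hzB, hzf⟩ ⟨hzB', hzf'⟩
    rw [mem_preimage, hB.interior_eq, T.label_binaryRefinement_ρ] at hzf hzf'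
    dsimp only at hzf hzf'
    obtain ⟨w, hw, hwz⟩ := hB.exists_eq M.horizontal (a := a) hz
    obtain ⟨w', hw', hwz'⟩ := hB.exists_eq M.horizontal (a := a) hz'
    rw [((hB.sameDirections a) z hz z' hz' w hw w' hw' hwz.symm hwz'.symm).2]
    rw [hB.interior_eq, ← hwz] at hzB
    rw [hB.interior_eq, ← hwz'] at hzB'
    rw [← hwz] at hzf
    rw [← hwz'] at hzf'
    obtain ⟨y, hy, hyf⟩ := M.horizontal.subset_interior _ _ hzf
    obtain ⟨y', hy', hyf'⟩ := M.horizontal.subset_interior _ _ hzf'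
    rw [← hyf] at hzf
    rw [← hyf'] at hzf'
    obtain ⟨hpos, -⟩ := M.height_lt_iff (T.label a) hw hw' hy hy' hzB hzB' hyf hyf'
    obtain ⟨-, hneg⟩ := M.height_lt_iff (T.label a) hw' hw hy' hy hzB' hzB hyf' hyf
    by_cases hε : T.ε (T.label a) = 1
    · rw [← hpos hε]
      simp only [GeometricType.flip, hε] at hzf hzf'
      exact M.horizontal.2 _ j j' hjj y hy y' hy' hzf hzf'
    · rw [← hneg hε]
      simp only [GeometricType.flip, hε] at hzf hzf'
      exact M.horizontal.2 _ j'.rev j.rev (Fin.rev_lt_rev.2 hjj) y' hy' y hy hzf' hzf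

/-- The `l`-th vertical sub-rectangle of `B b` lies in the `l`-th vertical sub-rectangle of the
rectangle of `R` that contains `B b`. -/
theorem isVerticalLabelling (hB : IsRefinement f T R H B) (M : IsMarkovLabelling f T R H V) :
    IsVerticalLabelling f B T.binaryRefinement.v fun b l =>
      f.map '' (B (T.binaryRefinement.ρ.symm ⟨b, l⟩).1).interior ∩ (B b).interior := by
  constructor
  · intro b
    ext C
    simp only [mem_range, mem_iUnion, hB.componentsOf_image_inter M]
    constructor
    · rintro ⟨l, rfl⟩
      refine ⟨(T.binaryRefinement.ρ.symm ⟨b, l⟩).1, ?_⟩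
      rw [if_pos ((T.exists_binaryRefinement_ρ_fst_eq_iff _ b).1
        ⟨(T.binaryRefinement.ρ.symm ⟨b, l⟩).2, by simp⟩)]
      rfl
    · rintro ⟨a, ha⟩
      split_ifs at ha with h
      · obtain ⟨j, rfl⟩ := (T.exists_binaryRefinement_ρ_fst_eq_iff a b).2 h
        refine ⟨(T.binaryRefinement.ρ ⟨a, j⟩).2, ?_⟩
        rw [Sigma.eta, Equiv.symm_apply_apply]
        exact ha.symm
      · exact ha.elim
  · rintro b (l : Fin (T.v (T.label b).1)) (l' : Fin (T.v (T.label b).1)) hll z hz z' hz'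
      ⟨hzV, -⟩ ⟨hzV', -⟩
    have hV : ∀ l : Fin (T.v (T.label b).1),
        f.map '' (B (T.binaryRefinement.ρ.symm ⟨b, l⟩).1).interior = V (T.label b).1 l := by
      intro l
      rw [hB.interior_eq, M.image_eq, T.ρ_label_binaryRefinement_symm]
    obtain ⟨w, hw, hwz⟩ := hB.exists_eq M.horizontal (a := b) hz
    obtain ⟨w', hw', hwz'⟩ := hB.exists_eq M.horizontal (a := b) hz'
    rw [((hB.sameDirections b) z hz z' hz' w hw w' hw' hwz.symm hwz'.symm).1]
    rw [hV, ← hwz] at hzV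
    rw [hV, ← hwz'] at hzV'
    exact M.vertical.2 _ l l' hll w hw w' hw' hzV hzV'

/-- The orientation part of the refinement is that of `T`: on the part of `B a` sent into `B b`, the
vertical directions are those of `R`. -/
theorem preservesVerticalOn_iff (hB : IsRefinement f T R H B) (M : IsMarkovLabelling f T R H V)
    {a b : Fin T.binaryRefinement.n} (hab : (T.label b).1 = (T.ρ (T.label a)).1) :
    T.ε (T.label a) = 1 ↔
      PreservesVerticalOn f (B a) (B b) ((B a).interior ∩ f.map ⁻¹' (B b).interior) := by
  -- two points of `B a` sent into `B b`: heights of the images against heights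
  have key : ∀ z ∈ openSquare, ∀ z' ∈ openSquare, ∀ w ∈ openSquare, ∀ w' ∈ openSquare,
      (B b).ρ w = f.map ((B a).ρ z) → (B b).ρ w' = f.map ((B a).ρ z') →
      (T.ε (T.label a) = 1 → (w.2 < w'.2 ↔ z.2 < z'.2)) ∧
        (T.ε (T.label a) ≠ 1 → (w.2 < w'.2 ↔ z'.2 < z.2)) := by
    intro z hz z' hz' w hw w' hw' h h'
    obtain ⟨u, hu, huz⟩ := hB.exists_eq M.horizontal (a := a) hz
    obtain ⟨u', hu', huz'⟩ := hB.exists_eq M.horizontal (a := a) hz'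
    obtain ⟨y, hy, hyw⟩ := hB.exists_eq M.horizontal (a := b) hw
    obtain ⟨y', hy', hyw'⟩ := hB.exists_eq M.horizontal (a := b) hw'
    have huH : (R (T.label a).1).ρ u ∈ H (T.label a).1 (T.label a).2 := by
      rw [← hB.interior_eq, huz]
      exact ⟨z, hz, rfl⟩
    have huH' : (R (T.label a).1).ρ u' ∈ H (T.label a).1 (T.label a).2 := by
      rw [← hB.interior_eq, huz']
      exact ⟨z', hz', rfl⟩
    rw [((hB.sameDirections a) z hz z' hz' u hu u' hu' huz.symm huz'.symm).2,
      ((hB.sameDirections a) z' hz' z hz u' hu' u hu huz'.symm huz.symm).2,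
      ((hB.sameDirections b) w hw w' hw' y hy y' hy' hyw.symm hyw'.symm).2]
    rw [← huz, ← hyw, hab] at h
    rw [← huz', ← hyw', hab] at h'
    exact M.height_lt_iff (T.label a) hu hu' hy hy' huH huH' h h'
  constructor
  · intro hε s t t' hst hst' htt _ _ w hw w' hw' h h'
    exact ((key _ hst _ hst' w hw w' hw' h h').1 hε).2 htt
  · intro hP
    by_contra hε
    -- a vertical segment of `B a` in the strip that is sent into `B b`
    obtain ⟨p, q, hp, hpq, hq, heq⟩ := M.inter_preimage_eq hab
    rw [← hB.interior_eq, ← hB.interior_eq] at heq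
    obtain ⟨t, hpt, htq⟩ := exists_between hpq
    obtain ⟨t', htt', ht'q⟩ := exists_between htq
    have hsub := Ioo_prod_Ioo_subset_openSquare (le_refl (0 : ℝ)) (le_refl (1 : ℝ)) hp hq
    have hu : ((1 / 2 : ℝ), t) ∈ Ioo (0 : ℝ) 1 ×ˢ Ioo p q := ⟨by norm_num, hpt, htq⟩
    have hu' : ((1 / 2 : ℝ), t') ∈ Ioo (0 : ℝ) 1 ×ˢ Ioo p q :=
      ⟨by norm_num, hpt.trans htt', ht'q⟩
    have hmem : (R (T.label a).1).ρ (1 / 2, t) ∈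
        (B a).interior ∩ f.map ⁻¹' (B b).interior := heq ▸ mem_image_of_mem _ hu
    have hmem' : (R (T.label a).1).ρ (1 / 2, t') ∈
        (B a).interior ∩ f.map ⁻¹' (B b).interior := heq ▸ mem_image_of_mem _ hu'
    obtain ⟨⟨s₁, t₁⟩, hz, hzu⟩ := hmem.1
    obtain ⟨⟨s₂, t₂⟩, hz', hzu'⟩ := hmem'.1
    obtain ⟨w, hw, hwf⟩ := hmem.2
    obtain ⟨w', hw', hwf'⟩ := hmem'.2
    rw [← hzu] at hmem hwf
    rw [← hzu'] at hmem' hwf'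
    have hs : s₁ = s₂ :=
      ((hB.sameDirections a).fst_eq_iff hz hz' (hsub hu) (hsub hu') hzu hzu').2 rfl
    have ht : t₁ < t₂ :=
      ((hB.sameDirections a) _ hz _ hz' _ (hsub hu) _ (hsub hu') hzu hzu').2.2 htt'
    subst hs
    have hlt := hP s₁ t₁ t₂ hz hz' ht hmem hmem' w hw w' hw' hwf hwf'
    exact lt_asymm ht (((key _ hz _ hz' w hw w' hw' hwf hwf').2 hε).1 hlt)

theorem hasGeometricType (hB : IsRefinement f T R H B) (M : IsMarkovLabelling f T R H V) :
    HasGeometricType f T.binaryRefinement B := by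
  refine ⟨_, _, hB.isHorizontalLabelling M, hB.isVerticalLabelling M, ?_, ?_⟩
  · intro x
    rw [image_inter_preimage, Sigma.eta, Sigma.eta, Equiv.symm_apply_apply]
  · rintro ⟨a, j⟩
    exact hB.preservesVerticalOn_iff M ((T.exists_binaryRefinement_ρ_fst_eq_iff a _).1 ⟨j, rfl⟩)

end IsRefinement

theorem HasGeometricType.exists_isHorizontalRefinement (hT : HasGeometricType f T R)
    (hM : IsGeometricMarkovPartition f R) : ∃ B, IsHorizontalRefinement f T R B := by
  obtain ⟨H, V, M⟩ := hT.exists_isMarkovLabelling hM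
  exact M.horizontal.exists_isHorizontalRefinement M.markov

theorem IsHorizontalRefinement.geometricType {B : Fin T.binaryRefinement.n → GeometricRectangle f}
    (hB : IsHorizontalRefinement f T R B) (hT : HasGeometricType f T R)
    (hM : IsGeometricMarkovPartition f R) :
    IsGeometricMarkovPartition f B ∧ HasGeometricType f T.binaryRefinement B ∧
      partitionIncidence f B = T.binaryRefinement.incidence := by
  obtain ⟨H, V, M⟩ := hT.exists_isMarkovLabelling hM
  have hB' := hB.isRefinement M.horizontal
  exact ⟨hB'.isGeometricMarkovPartition M, hB'.hasGeometricType M, hB'.partitionIncidence_eq M⟩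

end

theorem mainTheorem2 :
    (∃ F : List (ℕ × List (ℕ × ℕ × Bool)) → List (ℕ × List (ℕ × ℕ × Bool)),
      Computable F ∧ ∀ T : GeometricType, F T.code = T.binaryRefinement.code) ∧
    ∀ (T : GeometricType)
      (S : Type u) [TopologicalSpace S] [ChartedSpace ℂ S] [ClosedOrientedSurface S]
      (S' : Type v) [TopologicalSpace S'] [ChartedSpace ℂ S'] [ClosedOrientedSurface S']
      (f : PseudoAnosov S) (g : PseudoAnosov S')
      (Rf : Fin T.n → GeometricRectangle f) (Rg : Fin T.n → GeometricRectangle g),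
      IsGeometricMarkovPartition f Rf → IsGeometricMarkovPartition g Rg →
      HasGeometricType f T Rf → HasGeometricType g T Rg →
      (∃ Bf, IsHorizontalRefinement f T Rf Bf) ∧ (∃ Bg, IsHorizontalRefinement g T Rg Bg) ∧
      (∀ Bf, IsHorizontalRefinement f T Rf Bf →
        IsGeometricMarkovPartition f Bf ∧ HasGeometricType f T.binaryRefinement Bf ∧
        partitionIncidence f Bf = T.binaryRefinement.incidence) ∧
      (∀ Bg, IsHorizontalRefinement g T Rg Bg →
        IsGeometricMarkovPartition g Bg ∧ HasGeometricType g T.binaryRefinement Bg ∧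
        partitionIncidence g Bg = T.binaryRefinement.incidence) ∧
      IsBinary T.binaryRefinement.incidence ∧
      GeometricType.IsSymbolicallyPresentable.{u} T.binaryRefinement := by
  refine ⟨⟨GeometricType.refineCode, GeometricType.primrec_refineCode.to_comp,
    GeometricType.refineCode_code⟩, ?_⟩
  intro T S _ _ _ S' _ _ _ f g Rf Rg hMf hMg hTf hTg
  obtain ⟨B, hB⟩ := hTf.exists_isHorizontalRefinement hMf
  obtain ⟨hMB, hTB, -⟩ := hB.geometricType hTf hMf
  exact ⟨⟨B, hB⟩, hTg.exists_isHorizontalRefinement hMg,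
    fun _ h => h.geometricType hTf hMf, fun _ h => h.geometricType hTg hMg,
    T.isBinary_incidence_binaryRefinement,
    ⟨S, _, _, inferInstance, f, B, hMB, hTB⟩, T.isBinary_incidence_binaryRefinement⟩
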